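/- Let $f\not\equiv 0$ be a meromorphic function in $\mathbb C$ of finite order $$\sigma=\limsup_{r\to\infty}\frac{\log^+ T(r,f)}{\log r}<\infty ,$$ where $T(r,f)$ is the Nevanlinna characteristic, and let $\eta\in\mathbb C\setminus\{0\}$. Let $\lambda'$ and $\lambda''$ be the exponents of convergence of the zeros and of the poles of $f$, that is, the infimum of all $\tau>0$ such that $\sum |a|^{-\tau}<\infty$, where $a$ runs over the nonzero zeros, respectively the nonzero poles, of $f$, repeated according to multiplicity. Put $\lambda=\max\{\lambda',\lambda''\}$ and $$\beta=\begin{cases}\max\{\sigma-2,\;2\lambda-2\}, & \lambda<1,\\ \max\{\sigma-2,\;\lambda-1\}, & \lambda\ge 1.\end{cases}$$ Then for every $\varepsilon>0$ there is a measurable set $E\subset(1,\infty)$ of finite logarithmic measure, $\int_E \frac{dr}{r}<\infty$, such that for all $z$ with $r=|z|\notin E\cup[0,1]$ neither $z$ nor $z+\eta$ is a zero or a pole of $f$, and $$2\pi i\,n_{z,\eta}+\log\frac{f(z+\eta)}{f(z)}=\eta\,\frac{f'(z)}{f(z)}+O\bigl(r^{\beta+\varepsilon}\bigr)$$ with integers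 $n_{z,\eta}$ depending on $z$ and $\eta$ ($\log$ being the principal branch), and equivalently $$\frac{f(z+\eta)}{f(z)}=\exp\Bigl(\eta\,\frac{f'(z)}{f(z)}+O\bigl(r^{\beta+\varepsilon}\bigr)\Bigr).$$ Here $O(r^{\beta+\varepsilon})$ stands for a function $R(z)$ for which there are $r_0,K>0$ with $|R(z)|\le K r^{\beta+\varepsilon}$ whenever $|z|=r>r_0$. -/

import Mathlib

open Set Filter Topology MeasureTheory

noncomputable section

namespace MeromorphicGrowth

/-- The logarithmic measure `∫_{E ∩ (1,∞)} dr / r` of a set of positive reals. -/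
def logMeasure (E : Set ℝ) : ENNReal :=
  ∫⁻ r in E ∩ Ioi 1, ENNReal.ofReal (1 / r)

/-- The order of growth `limsup_{r → ∞} log⁺ T(r, f) / log r`, where `T(r, f)` is the Nevanlinna
characteristic `m(r, f) + N(r, f)`. The positive part of the logarithm only matters for
constant functions (whose order is `0`). -/
def order (f : ℂ → ℂ) : EReal :=
  limsup (fun r : ℝ =>
    ((Real.posLog (ValueDistribution.characteristic f ⊤ r) / Real.log r : ℝ) : EReal)) atTop

/-- The exponent of convergence of a locally finite family of points of `ℂ`, the point `a` being
repeated `D a` times (`D ≥ 0`): the infimum of all `τ > 0` for which `∑_{a ≠ 0} D a * |a| ^ (-τ)`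
converges (`⊤` if there is no such `τ`). -/
def exponentOfConvergence (D : Function.locallyFinsupp ℂ ℤ) : EReal :=
  sInf ((fun τ : ℝ => (τ : EReal)) ''
    {τ : ℝ | 0 < τ ∧ Summable fun a : {a : ℂ // a ≠ 0} => (D a : ℝ) * ‖(a : ℂ)‖ ^ (-τ)})

/-- Exponent of convergence of the zeros of `f`, counted with multiplicity. -/
def zerosExponent (f : ℂ → ℂ) : EReal :=
  exponentOfConvergence (MeromorphicOn.divisor f univ)⁺

/-- Exponent of convergence of the poles of `f`, counted with multiplicity. -/
def polesExponent (f : ℂ → ℂ) : EReal :=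
  exponentOfConvergence (MeromorphicOn.divisor f univ)⁻

/-- The exponent `β` as a function of the order `σ` and of the exponent of convergence `lam`. -/
def beta (σ lam : ℝ) : ℝ :=
  if lam < 1 then max (σ - 2) (2 * lam - 2) else max (σ - 2) (lam - 1)

/-- `g(z) = O(ψ(r))` with `r = |z|`, as `r → ∞`. -/
def IsBigOModulus (g : ℂ → ℂ) (ψ : ℝ → ℝ) : Prop :=
  ∃ r₀ > 0, ∃ K > 0, ∀ z : ℂ, r₀ < ‖z‖ → ‖g z‖ ≤ K * ψ ‖z‖

end MeromorphicGrowth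

end

/-!
On the disk of radius `3 * ‖z‖`, write `f` as a rational function with the same zeros and poles
times a zero-free analytic function `g`. Since `log g` is the Schwarz integral of `log ‖g‖` up to a
constant, its increment differs from its first-order approximation by
`O(r ^ (-2) * (T(r, f) + n(r) * log r))`, where `n(r)` counts zeros and poles; this is the term
`σ - 2` of `β`. A zero or pole `a` adds, up to sign, the remainder
`log (1 + η / (z - a)) - η / (z - a)`, which is bounded both linearly and quadratically in the
reciprocal distances of `r` to `‖a‖` and `‖a - η‖`. The sums of these reciprocal distances are
small outside a set of finite logarithmic measure: their `p`-th powers are integrable for `p < 1`,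
so Markov's inequality applies.
-/

namespace MeromorphicGrowth

section LogRemainder

/-- The remainder `log (1 + w) - w` of the first-order expansion of the principal logarithm
at `1`. It controls the contribution of a single zero or pole. -/
noncomputable def logRemainder (w : ℂ) : ℂ :=
  Complex.log (1 + w) - w

lemma log_norm_one_add_le (w : ℂ) : Real.log ‖1 + w‖ ≤ ‖w‖ := by
  rcases eq_or_ne (1 + w) 0 with h | h
  · simp [h]
  · have h_log := Real.log_le_sub_one_of_pos (norm_pos_iff.2 h)
    have h_tri := norm_add_le 1 w
    rw [norm_one] at h_tri
    linarith

lemma abs_log_norm_one_add_le {w : ℂ} (hw : 1 + w ≠ 0) :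
    |Real.log ‖1 + w‖| ≤ ‖w‖ + ‖w / (1 + w)‖ := by
  rw [abs_le]
  constructor
  · have h_inv : 1 + -(w / (1 + w)) = (1 + w)⁻¹ := by field_simp; ring
    have h := log_norm_one_add_le (-(w / (1 + w)))
    rw [h_inv, norm_inv, Real.log_inv, norm_neg] at h
    linarith [norm_nonneg w]
  · linarith [log_norm_one_add_le w, norm_nonneg (w / (1 + w))]

lemma norm_logRemainder_le {w : ℂ} (hw : 1 + w ≠ 0) :
    ‖logRemainder w‖ ≤ 2 * ‖w‖ + ‖w / (1 + w)‖ + 4 := by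
  have h_log : ‖Complex.log (1 + w)‖ ≤ |Real.log ‖1 + w‖| + |(1 + w).arg| := by
    simpa only [Complex.log_re, Complex.log_im] using
      Complex.norm_le_abs_re_add_abs_im (Complex.log (1 + w))
  have h_sub : ‖logRemainder w‖ ≤ ‖Complex.log (1 + w)‖ + ‖w‖ := norm_sub_le _ _
  linarith [Real.pi_le_four, Complex.abs_arg_le_pi (1 + w), abs_log_norm_one_add_le hw]

lemma norm_logRemainder_le_sq {w : ℂ} (hw : ‖w‖ ≤ 1 / 2) : ‖logRemainder w‖ ≤ ‖w‖ ^ 2 := by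
  have h_taylor : ‖logRemainder w‖ ≤ ‖w‖ ^ 2 * (1 - ‖w‖)⁻¹ / 2 :=
    Complex.norm_log_one_add_sub_self_le (by linarith)
  have h_inv : (1 - ‖w‖)⁻¹ ≤ 2 := by
    rw [inv_le_comm₀ (by linarith) (by norm_num)]
    linarith
  nlinarith [sq_nonneg ‖w‖]

lemma norm_logRemainder_le_pow {w : ℂ} (hw : 1 + w ≠ 0) {k : ℕ} (hk₁ : 1 ≤ k) (hk₂ : k ≤ 2) :
    ‖logRemainder w‖ ≤ 25 * (‖w‖ ^ k + ‖w / (1 + w)‖ ^ k) := by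
  have h_nonneg : 0 ≤ ‖w / (1 + w)‖ := norm_nonneg _
  rcases le_or_gt ‖w‖ (1 / 2) with h | h
  · have h_pow : ‖w‖ ^ 2 ≤ ‖w‖ ^ k :=
      pow_le_pow_of_le_one (norm_nonneg w) (by linarith) hk₂
    linarith [norm_logRemainder_le_sq h, pow_nonneg (norm_nonneg w) k, pow_nonneg h_nonneg k]
  · have h_crude := norm_logRemainder_le hw
    interval_cases k
    · linarith
    · nlinarith [sq_nonneg (‖w / (1 + w)‖ - 1)]

end LogRemainder

section SchwarzIntegral

open Real Metric

/-- The Schwarz integral of a real function `u` on the circle of radius `R` about `0`: the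
holomorphic function on the disk whose real part is the Poisson integral of `u` and which is real
at `0`. -/
noncomputable def schwarzIntegral (u : ℂ → ℝ) (R : ℝ) (w : ℂ) : ℂ :=
  circleAverage (fun ζ => herglotzRieszKernel 0 w ζ • (u ζ : ℂ)) 0 R

lemma norm_circleAverage_le {E : Type*} [NormedAddCommGroup E] [NormedSpace ℝ E] {F : ℂ → E}
    {u : ℂ → ℝ} {c : ℂ} {R : ℝ} (hu : CircleIntegrable u c R)
    (hF : ∀ ζ ∈ sphere c |R|, ‖F ζ‖ ≤ u ζ) :
    ‖circleAverage F c R‖ ≤ circleAverage u c R := by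
  rw [circleAverage, circleAverage, norm_smul, norm_eq_abs, abs_of_pos (by positivity), smul_eq_mul]
  gcongr
  exact intervalIntegral.norm_integral_le_of_norm_le (by positivity)
    (Eventually.of_forall fun θ _ => hF _ (circleMap_mem_sphere' c R θ)) hu

lemma herglotzRieszKernel_add_sub_sub {w η ζ : ℂ} (hw : ζ - w ≠ 0) (hwη : ζ - (w + η) ≠ 0) :
    herglotzRieszKernel 0 (w + η) ζ - herglotzRieszKernel 0 w ζ - η * (2 * ζ / (ζ - w) ^ 2)
      = 2 * ζ * η ^ 2 / ((ζ - w) ^ 2 * (ζ - (w + η))) := by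
  simp only [herglotzRieszKernel_def, sub_zero]
  field_simp
  ring

lemma norm_herglotzRieszKernel_add_sub_sub_le {w η ζ : ℂ} (h : ‖w‖ + ‖η‖ < ‖ζ‖) :
    ‖herglotzRieszKernel 0 (w + η) ζ - herglotzRieszKernel 0 w ζ - η * (2 * ζ / (ζ - w) ^ 2)‖
      ≤ 2 * ‖ζ‖ * ‖η‖ ^ 2 / ((‖ζ‖ - ‖w‖) ^ 2 * (‖ζ‖ - ‖w‖ - ‖η‖)) := by
  have h_pos₁ : 0 < ‖ζ‖ - ‖w‖ - ‖η‖ := by linarith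
  have h_pos₂ : 0 < ‖ζ‖ - ‖w‖ := by linarith [norm_nonneg η]
  have h_dist₁ : ‖ζ‖ - ‖w‖ - ‖η‖ ≤ ‖ζ - (w + η)‖ := by
    linarith [norm_sub_norm_le ζ (w + η), norm_add_le w η]
  have h_dist₂ : ‖ζ‖ - ‖w‖ ≤ ‖ζ - w‖ := norm_sub_norm_le ζ w
  rw [herglotzRieszKernel_add_sub_sub (norm_pos_iff.1 (h_pos₂.trans_le h_dist₂))
    (norm_pos_iff.1 (h_pos₁.trans_le h_dist₁)), norm_div, norm_mul, norm_mul, norm_mul, norm_pow,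
    norm_pow, Complex.norm_two]
  gcongr

variable {u : ℂ → ℝ} {R : ℝ}

lemma circleIntegrable_ofReal {c : ℂ} (hu : CircleIntegrable u c R) :
    CircleIntegrable (fun ζ => (u ζ : ℂ)) c R :=
  ⟨hu.1.ofReal, hu.2.ofReal⟩

lemma hasDerivAt_schwarzIntegral (hu : CircleIntegrable u 0 R) {w : ℂ} (hw : w ∈ ball 0 R) :
    HasDerivAt (schwarzIntegral u R)
      (circleAverage (fun ζ => (2 * ζ / (ζ - w) ^ 2) • (u ζ : ℂ)) 0 R) w :=
  hasDerivAt_circleAverage_herglotzRieszKernel_smul (circleIntegrable_ofReal hu) hw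

lemma schwarzIntegral_add_sub_sub (hu : CircleIntegrable u 0 R) {z η : ℂ} (hz : z ∈ ball 0 R)
    (hzη : z + η ∈ ball 0 R) :
    schwarzIntegral u R (z + η) - schwarzIntegral u R z - η * deriv (schwarzIntegral u R) z =
      circleAverage (fun ζ =>
        (herglotzRieszKernel 0 (z + η) ζ - herglotzRieszKernel 0 z ζ - η * (2 * ζ / (ζ - z) ^ 2))
          • (u ζ : ℂ)) 0 R := by
  have h_kernel : ∀ w ∈ ball (0 : ℂ) R,
      CircleIntegrable (fun ζ => herglotzRieszKernel 0 w ζ • (u ζ : ℂ)) 0 R := fun w hw =>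
    (circleIntegrable_ofReal hu).continuousOn_smul (continuousOn_herglotzRieszKernel_sphere hw)
  have h_deriv : CircleIntegrable (fun ζ => η • ((2 * ζ / (ζ - z) ^ 2) • (u ζ : ℂ))) 0 R := by
    have h_cont : ContinuousOn (fun ζ : ℂ => 2 * ζ / (ζ - z) ^ 2) (sphere 0 |R|) := by
      refine .div (by fun_prop) (by fun_prop) fun ζ hζ => pow_ne_zero _ (sub_ne_zero.2 ?_)
      rintro rfl
      simp only [mem_sphere_iff_norm, mem_ball, dist_zero_right, sub_zero] at hζ hz
      linarith [le_abs_self R]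
    exact ((circleIntegrable_ofReal hu).continuousOn_smul h_cont).const_smul
  rw [(hasDerivAt_schwarzIntegral hu hz).deriv, schwarzIntegral, schwarzIntegral, ← smul_eq_mul,
    ← circleAverage_fun_smul, ← circleAverage_fun_sub (h_kernel _ hzη) (h_kernel _ hz),
    ← circleAverage_fun_sub (f₁ := fun ζ => _ - _) ((h_kernel _ hzη).sub (h_kernel _ hz)) h_deriv]
  simp only [smul_eq_mul, sub_mul, mul_assoc]

lemma norm_schwarzIntegral_add_sub_sub_le (hu : CircleIntegrable u 0 R) {z η : ℂ}
    (hz : ‖z‖ + ‖η‖ < R) :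
    ‖schwarzIntegral u R (z + η) - schwarzIntegral u R z - η * deriv (schwarzIntegral u R) z‖
      ≤ 2 * R * ‖η‖ ^ 2 / ((R - ‖z‖) ^ 2 * (R - ‖z‖ - ‖η‖)) *
        circleAverage (fun ζ => |u ζ|) 0 R := by
  have hz₁ : z ∈ ball (0 : ℂ) R := by simpa using by linarith [norm_nonneg η]
  have hz₂ : z + η ∈ ball (0 : ℂ) R := by simpa using (norm_add_le z η).trans_lt hz
  rw [schwarzIntegral_add_sub_sub hu hz₁ hz₂, ← smul_eq_mul, ← circleAverage_fun_smul]
  refine norm_circleAverage_le (hu.abs.const_fun_smul) fun ζ hζ => ?_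
  have hζR : ‖ζ‖ = R := by
    rwa [mem_sphere_zero_iff_norm, abs_of_pos (pos_of_mem_ball hz₁)] at hζ
  rw [norm_smul, Complex.norm_real, norm_eq_abs, smul_eq_mul, ← hζR]
  gcongr
  exact norm_herglotzRieszKernel_add_sub_sub_le (hζR ▸ hz)

variable {g : ℂ → ℂ}

lemma circleIntegrable_log_norm_of_ne_zero (hR : 0 < R) (hg : ContinuousOn g (sphere 0 R))
    (hg0 : ∀ z ∈ sphere 0 R, g z ≠ 0) : CircleIntegrable (fun ζ => log ‖g ζ‖) 0 R :=
  (hg.norm.log fun z hz => norm_ne_zero_iff.2 (hg0 z hz)).circleIntegrable hR.le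

lemma exists_exp_schwarzIntegral_eq (hR : 0 < R) (hg : AnalyticOnNhd ℂ g (closedBall 0 R))
    (hg0 : ∀ z ∈ closedBall 0 R, g z ≠ 0) :
    ∃ c : ℂ, c ≠ 0 ∧ ∀ w ∈ ball (0 : ℂ) R,
      Complex.exp (schwarzIntegral (fun ζ => log ‖g ζ‖) R w) = c * g w := by
  have h_int : CircleIntegrable (fun ζ => log ‖g ζ‖) 0 R :=
    circleIntegrable_log_norm_of_ne_zero hR (hg.continuousOn.mono sphere_subset_closedBall)
      fun z hz => hg0 z (sphere_subset_closedBall hz)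
  have h_re : ∀ w ∈ ball (0 : ℂ) R,
      (schwarzIntegral (fun ζ => log ‖g ζ‖) R w).re = log ‖g w‖ := fun w hw => by
    rw [schwarzIntegral, re_circleAverage_herglotzRieszKernel_smul h_int hw]
    exact InnerProductSpace.HarmonicOnNhd.circleAverage_re_herglotzRieszKernel_smul
      (fun x hx => (hg x hx).harmonicAt_log_norm (hg0 x hx)) hw
  set q : ℂ → ℂ := fun w => Complex.exp (schwarzIntegral (fun ζ => log ‖g ζ‖) R w) / g w with hq
  have hq_norm : ∀ w ∈ ball (0 : ℂ) R, ‖q w‖ = 1 := fun w hw => by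
    have hgw := norm_pos_iff.2 (hg0 w (ball_subset_closedBall hw))
    rw [hq, norm_div, Complex.norm_exp, h_re w hw, exp_log hgw, div_self hgw.ne']
  have hq_diff : DifferentiableOn ℂ q (ball 0 R) := fun w hw =>
    ((hasDerivAt_schwarzIntegral h_int hw).differentiableAt.cexp.div
      (hg w (ball_subset_closedBall hw)).differentiableAt
      (hg0 w (ball_subset_closedBall hw))).differentiableWithinAt
  have h_zero : (0 : ℂ) ∈ ball (0 : ℂ) R := mem_ball_self hR
  have hq_const := Complex.eqOn_of_isPreconnected_of_isMaxOn_norm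
    (convex_ball (0 : ℂ) R).isPreconnected isOpen_ball hq_diff h_zero
    (fun w hw => by simp [hq_norm w hw, hq_norm 0 h_zero])
  refine ⟨q 0, norm_ne_zero_iff.1 (by simp [hq_norm 0 h_zero]), fun w hw => ?_⟩
  rw [← div_eq_iff (hg0 w (ball_subset_closedBall hw))]
  exact hq_const hw

lemma exists_quotient_eq_exp_of_ne_zero (hg : AnalyticOnNhd ℂ g (closedBall 0 R))
    (hg0 : ∀ z ∈ closedBall 0 R, g z ≠ 0) {z η : ℂ} (hz : ‖z‖ + ‖η‖ < R) :
    ∃ ρ : ℂ, g (z + η) / g z = Complex.exp (η * logDeriv g z + ρ) ∧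
      ‖ρ‖ ≤ 2 * R * ‖η‖ ^ 2 / ((R - ‖z‖) ^ 2 * (R - ‖z‖ - ‖η‖))
        * circleAverage (fun ζ => |log ‖g ζ‖|) 0 R := by
  have hz₁ : z ∈ ball (0 : ℂ) R := by simpa using by linarith [norm_nonneg η]
  have hz₂ : z + η ∈ ball (0 : ℂ) R := by simpa using (norm_add_le z η).trans_lt hz
  have hR : 0 < R := pos_of_mem_ball hz₁
  have h_int := circleIntegrable_log_norm_of_ne_zero hR
    (hg.continuousOn.mono sphere_subset_closedBall)
    fun z hz => hg0 z (sphere_subset_closedBall hz)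
  obtain ⟨c, hc, h_exp⟩ := exists_exp_schwarzIntegral_eq hR hg hg0
  set S := schwarzIntegral (fun ζ => log ‖g ζ‖) R
  have h_logDeriv : deriv S z = logDeriv g z := by
    have h_eventually : (fun w => Complex.exp (S w)) =ᶠ[𝓝 z] fun w => c * g w :=
      (isOpen_ball.eventually_mem hz₁).mono h_exp
    rw [← logDeriv_const_mul (f := g) z c hc, ← (logDeriv_congr_nhds h_eventually).self_of_nhds]
    have hS := (hasDerivAt_schwarzIntegral h_int hz₁).differentiableAt.hasDerivAt
    rw [logDeriv_apply, hS.cexp.deriv, mul_div_cancel_left₀ _ (Complex.exp_ne_zero _)]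
  refine ⟨S (z + η) - S z - η * deriv S z, ?_, norm_schwarzIntegral_add_sub_sub_le h_int hz⟩
  rw [← h_logDeriv, add_sub_cancel, Complex.exp_sub, h_exp z hz₁, h_exp _ hz₂,
    mul_div_mul_left _ _ hc]

end SchwarzIntegral

section ExceptionalSet

/-- A measurable subset of `(1, ∞)` of finite logarithmic measure: the sets of radii that the
estimates may omit. -/
structure IsExceptional (E : Set ℝ) : Prop where
  subset_Ioi : E ⊆ Ioi 1
  measurableSet : MeasurableSet E
  logMeasure_lt_top : logMeasure E < ⊤

lemma IsExceptional.union {E E' : Set ℝ} (hE : IsExceptional E) (hE' : IsExceptional E') :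
    IsExceptional (E ∪ E') where
  subset_Ioi := union_subset hE.subset_Ioi hE'.subset_Ioi
  measurableSet := hE.measurableSet.union hE'.measurableSet
  logMeasure_lt_top := by
    rw [logMeasure, union_inter_distrib_right]
    exact (lintegral_union_le _ _ _).trans_lt
      (ENNReal.add_lt_top.2 ⟨hE.logMeasure_lt_top, hE'.logMeasure_lt_top⟩)

lemma isExceptional_of_countable {E : Set ℝ} (hE : E.Countable) (hE₁ : E ⊆ Ioi 1) :
    IsExceptional E where
  subset_Ioi := hE₁
  measurableSet := hE.measurableSet
  logMeasure_lt_top := by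
    rw [logMeasure, setLIntegral_measure_zero _ _ ((hE.mono inter_subset_left).measure_zero volume)]
    exact ENNReal.zero_lt_top

lemma exists_isExceptional_le_inv {Φ : ℝ → ENNReal} (hΦ : Measurable Φ)
    (h_int : ∫⁻ s in Ioi 1, Φ s < ⊤) :
    ∃ E, IsExceptional E ∧ ∀ s, 1 < s → s ∉ E → Φ s ≤ ENNReal.ofReal (1 / s) := by
  have h_meas : MeasurableSet (Ioi 1 ∩ {s | ENNReal.ofReal (1 / s) < Φ s}) :=
    measurableSet_Ioi.inter (measurableSet_lt (by fun_prop) hΦ)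
  refine ⟨_, ⟨inter_subset_left, h_meas, ?_⟩, fun s hs hsE => not_lt.1 fun h => hsE ⟨hs, h⟩⟩
  rw [logMeasure, inter_eq_left.2 inter_subset_left]
  calc _ ≤ ∫⁻ s in Ioi 1 ∩ {s | ENNReal.ofReal (1 / s) < Φ s}, Φ s :=
        setLIntegral_mono' h_meas fun s hs => hs.2.le
    _ ≤ ∫⁻ s in Ioi 1, Φ s := lintegral_mono_set inter_subset_left
    _ < ⊤ := h_int

end ExceptionalSet

section KernelIntegral

open Real

lemma lintegral_Ioc_rpow {b p : ℝ} (hb : 0 ≤ b) (hp : p < 1) :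
    ∫⁻ u in Ioc 0 b, ENNReal.ofReal (u ^ (-p)) = ENNReal.ofReal (b ^ (1 - p) / (1 - p)) := by
  have h_int : IntervalIntegrable (fun u : ℝ => u ^ (-p)) volume 0 b :=
    intervalIntegral.intervalIntegrable_rpow' (by linarith)
  rw [← ofReal_integral_eq_lintegral_ofReal
      ((intervalIntegrable_iff_integrableOn_Ioc_of_le hb).1 h_int),
    ← intervalIntegral.integral_of_le hb, integral_rpow (Or.inl (by linarith)),
    zero_rpow (by linarith), sub_zero, neg_add_eq_sub]
  exact ae_restrict_of_forall_mem measurableSet_Ioc fun u hu => rpow_nonneg hu.1.le _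

lemma lintegral_Ioi_rpow {c τ : ℝ} (hc : 0 < c) (hτ : 0 < τ) :
    ∫⁻ s in Ioi c, ENNReal.ofReal (s ^ (-τ - 1)) = ENNReal.ofReal (c ^ (-τ) / τ) := by
  rw [← ofReal_integral_eq_lintegral_ofReal (integrableOn_Ioi_rpow_of_lt (by linarith) hc),
    integral_Ioi_rpow_of_lt (by linarith) hc, sub_add_cancel, neg_div_neg_eq]
  exact ae_restrict_of_forall_mem measurableSet_Ioi fun u hu => rpow_nonneg (hc.trans hu).le _

lemma lintegral_abs_sub_rpow_le {b p : ℝ} (hb : 0 ≤ b) (hp₀ : 0 < p) (hp₁ : p < 1) (t : ℝ)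
    {S : Set ℝ} (hS : MeasurableSet S) (hSb : ∀ s ∈ S, |s - t| ≤ b) :
    ∫⁻ s in S, ENNReal.ofReal (|s - t| ^ (-p)) ≤ 2 * ENNReal.ofReal (b ^ (1 - p) / (1 - p)) := by
  set k : ℝ → ENNReal := (Ioc 0 b).indicator fun u => ENNReal.ofReal (u ^ (-p)) with hk
  have hk_meas : Measurable k := Measurable.indicator (by fun_prop) measurableSet_Ioc
  have hk_int : ∫⁻ u, k u = ENNReal.ofReal (b ^ (1 - p) / (1 - p)) := by
    rw [hk, lintegral_indicator measurableSet_Ioc, lintegral_Ioc_rpow hb hp₁]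
  calc ∫⁻ s in S, ENNReal.ofReal (|s - t| ^ (-p))
      ≤ ∫⁻ s in S, (k (s - t) + k (t - s)) := by
        refine setLIntegral_mono' hS fun s hs => ?_
        have hsb := hSb s hs
        rcases lt_trichotomy s t with h | rfl | h
        · rw [abs_sub_comm, abs_of_pos (sub_pos.2 h)] at hsb ⊢
          rw [hk, indicator_of_mem (show t - s ∈ Ioc 0 b from ⟨sub_pos.2 h, hsb⟩)]
          exact le_add_self
        · simp [zero_rpow (neg_ne_zero.2 hp₀.ne')]
        · rw [abs_of_pos (sub_pos.2 h)] at hsb ⊢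
          rw [hk, indicator_of_mem (show s - t ∈ Ioc 0 b from ⟨sub_pos.2 h, hsb⟩)]
          exact le_self_add
    _ ≤ ∫⁻ s, (k (s - t) + k (t - s)) := setLIntegral_le_lintegral _ _
    _ = 2 * ENNReal.ofReal (b ^ (1 - p) / (1 - p)) := by
        rw [lintegral_add_left (by fun_prop), lintegral_sub_right_eq_self k t,
          lintegral_sub_left_eq_self k t, hk_int, two_mul]

lemma rpow_le_of_mem_Ioc {c x s : ℝ} (hc : 1 ≤ c) (hx : 0 < x) (hs : s ∈ Ioc (x / c) (c * x))
    (e : ℝ) : s ^ e ≤ c ^ |e| * x ^ e := by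
  have hc₀ : 0 < c := by linarith
  have hs₀ : 0 < s := (by positivity : 0 < x / c).trans hs.1
  rw [← div_le_iff₀ (rpow_pos_of_pos hx _), ← div_rpow hs₀.le hx.le]
  rcases le_total 0 e with he | he
  · rw [abs_of_nonneg he]
    exact rpow_le_rpow (by positivity) ((div_le_iff₀ hx).2 hs.2) he
  · have h_inv : c⁻¹ ≤ s / x := by
      rw [le_div_iff₀ hx, inv_mul_eq_div]
      exact hs.1.le
    rw [abs_of_nonpos he, rpow_neg hc₀.le, ← inv_rpow hc₀.le]
    exact rpow_le_rpow_of_nonpos (by positivity) h_inv he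

lemma lintegral_near_kernel_le {p τ t : ℝ} (hp₀ : 0 < p) (hp₁ : p < 1) (ht : 0 ≤ t) :
    ∫⁻ s in Ioc ((1 + t) / 5) (5 * (1 + t)), ENNReal.ofReal (|s - t| ^ (-p) * s ^ (p - τ - 1))
      ≤ ENNReal.ofReal (5 ^ |p - τ - 1| * (2 * (5 ^ (1 - p) / (1 - p))) * (1 + t) ^ (-τ)) := by
  have := sub_pos.2 hp₁
  have hx₀ : 0 < 1 + t := by linarith
  have h_dist : ∀ s ∈ Ioc ((1 + t) / 5) (5 * (1 + t)), |s - t| ≤ 5 * (1 + t) := fun s hs => by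
    rw [abs_le]
    constructor <;> linarith [hs.1, hs.2]
  set x := 1 + t
  calc ∫⁻ s in Ioc (x / 5) (5 * x), ENNReal.ofReal (|s - t| ^ (-p) * s ^ (p - τ - 1))
      ≤ ∫⁻ s in Ioc (x / 5) (5 * x), ENNReal.ofReal (5 ^ |p - τ - 1| * x ^ (p - τ - 1)) *
          ENNReal.ofReal (|s - t| ^ (-p)) := by
        refine setLIntegral_mono' measurableSet_Ioc fun s hs => ?_
        rw [← ENNReal.ofReal_mul (by positivity), mul_comm]
        gcongr
        exact rpow_le_of_mem_Ioc (by norm_num) hx₀ hs _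
    _ ≤ ENNReal.ofReal (5 ^ |p - τ - 1| * x ^ (p - τ - 1)) *
          (2 * ENNReal.ofReal ((5 * x) ^ (1 - p) / (1 - p))) := by
        rw [lintegral_const_mul _ (by fun_prop)]
        gcongr
        exact lintegral_abs_sub_rpow_le (by positivity) hp₀ hp₁ t measurableSet_Ioc h_dist
    _ = ENNReal.ofReal (5 ^ |p - τ - 1| * (2 * (5 ^ (1 - p) / (1 - p))) * x ^ (-τ)) := by
        rw [← ENNReal.ofReal_ofNat 2, ← ENNReal.ofReal_mul (by norm_num),
          ← ENNReal.ofReal_mul (by positivity)]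
        congr 1
        rw [mul_rpow (by norm_num) hx₀.le, show -τ = (p - τ - 1) + (1 - p) by ring, rpow_add hx₀]
        ring

lemma lintegral_far_kernel_le {p τ t : ℝ} (hp : 0 < p) (hτ : 0 < τ) (ht : 0 ≤ t) :
    ∫⁻ s in Ioi (5 * (1 + t)), ENNReal.ofReal (|s - t| ^ (-p) * s ^ (p - τ - 1))
      ≤ ENNReal.ofReal (2 ^ p * (5 ^ (-τ) / τ) * (1 + t) ^ (-τ)) := by
  calc ∫⁻ s in Ioi (5 * (1 + t)), ENNReal.ofReal (|s - t| ^ (-p) * s ^ (p - τ - 1))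
      ≤ ∫⁻ s in Ioi (5 * (1 + t)), ENNReal.ofReal (2 ^ p) * ENNReal.ofReal (s ^ (-τ - 1)) := by
        refine setLIntegral_mono' measurableSet_Ioi fun s hs => ?_
        rw [mem_Ioi] at hs
        have hs₀ : 0 < s := by linarith
        have h_half : |s - t| ^ (-p) ≤ (s / 2) ^ (-p) := by
          rw [abs_of_pos (by linarith)]
          exact rpow_le_rpow_of_nonpos (by linarith) (by linarith) (by linarith)
        rw [← ENNReal.ofReal_mul (by positivity)]
        refine ENNReal.ofReal_le_ofReal ?_
        calc |s - t| ^ (-p) * s ^ (p - τ - 1) ≤ (s / 2) ^ (-p) * s ^ (p - τ - 1) := by gcongr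
          _ = 2 ^ p * s ^ (-τ - 1) := by
            rw [show -τ - 1 = -p + (p - τ - 1) by ring, rpow_add hs₀, div_rpow hs₀.le (by norm_num),
              rpow_neg (by norm_num : (0 : ℝ) ≤ 2)]
            field_simp
    _ = ENNReal.ofReal (2 ^ p * (5 ^ (-τ) / τ) * (1 + t) ^ (-τ)) := by
        rw [lintegral_const_mul _ (by fun_prop), lintegral_Ioi_rpow (by positivity) hτ,
          ← ENNReal.ofReal_mul (by positivity), mul_rpow (by norm_num) (by positivity)]
        congr 1
        ring

lemma exists_lintegral_kernel_le {p τ : ℝ} (hp₀ : 0 < p) (hp₁ : p < 1) (hτ : 0 < τ) :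
    ∃ C : ℝ, ∀ t : ℝ, 0 ≤ t →
      ∫⁻ s in Ioi 1 ∩ {s | t ≤ 4 * s}, ENNReal.ofReal (|s - t| ^ (-p) * s ^ (p - τ - 1))
        ≤ ENNReal.ofReal (C * (1 + t) ^ (-τ)) := by
  have := sub_pos.2 hp₁
  refine ⟨5 ^ |p - τ - 1| * (2 * (5 ^ (1 - p) / (1 - p))) + 2 ^ p * (5 ^ (-τ) / τ),
    fun t ht => ?_⟩
  have h_subset : Ioi 1 ∩ {s | t ≤ 4 * s} ⊆
      Ioc ((1 + t) / 5) (5 * (1 + t)) ∪ Ioi (5 * (1 + t)) := by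
    rintro s ⟨hs₁, hs₂⟩
    rw [mem_Ioi] at hs₁
    rw [mem_ofPred_eq] at hs₂
    rw [Ioc_union_Ioi_eq_Ioi (by linarith), mem_Ioi]
    linarith
  rw [add_mul, ENNReal.ofReal_add (by positivity) (by positivity)]
  exact (lintegral_mono_set h_subset).trans ((lintegral_union_le _ _ _).trans
    (add_le_add (lintegral_near_kernel_le hp₀ hp₁ ht) (lintegral_far_kernel_le hp₀ hτ ht)))

end KernelIntegral

section ReciprocalDistances

open Real

lemma exists_isExceptional_sum_rpow_le {ι : Type*} [Countable ι] {m t : ι → ℝ}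
    (hm : ∀ i, 0 ≤ m i) (ht : ∀ i, 0 ≤ t i) {p τ : ℝ} (hp₀ : 0 < p) (hp₁ : p < 1) (hτ : 0 < τ)
    (h_sum : Summable fun i => m i * (1 + t i) ^ (-τ)) :
    ∃ E, IsExceptional E ∧ ∀ s, 1 < s → s ∉ E → ∀ F : Finset ι, (∀ i ∈ F, t i ≤ 4 * s) →
      ∑ i ∈ F, m i * |s - t i| ^ (-p) ≤ s ^ (τ - p) := by
  obtain ⟨C, h_kernel⟩ := exists_lintegral_kernel_le hp₀ hp₁ hτ
  have h_meas : ∀ i, MeasurableSet {s : ℝ | t i ≤ 4 * s} := fun i =>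
    measurableSet_le measurable_const (by fun_prop)
  set φ : ι → ℝ → ENNReal := fun i => {s : ℝ | t i ≤ 4 * s}.indicator fun s =>
    ENNReal.ofReal (m i) * ENNReal.ofReal (|s - t i| ^ (-p) * s ^ (p - τ - 1)) with hφ
  have hφ_meas : ∀ i, Measurable (φ i) := fun i => Measurable.indicator (by fun_prop) (h_meas i)
  have hφ_int : ∫⁻ s in Ioi 1, ∑' i, φ i s < ⊤ := by
    calc ∫⁻ s in Ioi 1, ∑' i, φ i s = ∑' i, ∫⁻ s in Ioi 1, φ i s :=
          lintegral_tsum fun i => (hφ_meas i).aemeasurable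
      _ ≤ ∑' i, ENNReal.ofReal (C * (m i * (1 + t i) ^ (-τ))) := by
        refine ENNReal.tsum_le_tsum fun i => ?_
        rw [hφ, setLIntegral_indicator (h_meas i), lintegral_const_mul _ (by fun_prop), inter_comm,
          mul_left_comm, ENNReal.ofReal_mul (hm i)]
        gcongr
        exact h_kernel _ (ht i)
      _ < ⊤ := (h_sum.mul_left C).tsum_ofReal_ne_top.lt_top
  obtain ⟨E, hE, hEφ⟩ := exists_isExceptional_le_inv (.tsum hφ_meas) hφ_int
  refine ⟨E, hE, fun s hs hsE F hF => ?_⟩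
  have hs₀ : 0 < s := by linarith
  have h_eq : ∑ i ∈ F, φ i s
      = ENNReal.ofReal ((∑ i ∈ F, m i * |s - t i| ^ (-p)) * s ^ (p - τ - 1)) := by
    simp_rw [Finset.sum_mul, mul_assoc]
    rw [ENNReal.ofReal_sum_of_nonneg fun i _ => mul_nonneg (hm i) (by positivity)]
    refine Finset.sum_congr rfl fun i hi => ?_
    rw [hφ, ENNReal.ofReal_mul (hm i)]
    exact indicator_of_mem (show s ∈ {s : ℝ | t i ≤ 4 * s} from hF i hi) _
  have h_le := (ENNReal.sum_le_tsum (f := fun i => φ i s) F).trans (hEφ s hs hsE)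
  rw [h_eq, ENNReal.ofReal_le_ofReal_iff (by positivity), ← le_div_iff₀ (by positivity)] at h_le
  refine h_le.trans_eq ?_
  rw [one_div, ← rpow_neg_one, ← rpow_sub hs₀]
  ring_nf

lemma rpow_sum_le_sum_rpow {ι : Type*} (F : Finset ι) {x : ι → ℝ} (hx : ∀ i, 0 ≤ x i) {p : ℝ}
    (hp₀ : 0 < p) (hp₁ : p ≤ 1) : (∑ i ∈ F, x i) ^ p ≤ ∑ i ∈ F, x i ^ p :=
  Finset.le_sum_of_subadditive_on_pred (fun y : ℝ => y ^ p) (0 ≤ ·) (zero_rpow hp₀.ne').le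
    (fun _ _ ha hb => rpow_add_le_add_rpow ha hb hp₀.le hp₁) (fun _ _ => add_nonneg) x
    fun i _ => hx i

lemma exists_isExceptional_sum_inv_le_of_countable {ι : Type*} [Countable ι] {m : ι → ℕ}
    {t : ι → ℝ} (ht : ∀ i, 0 ≤ t i) {p τ : ℝ} (hp₀ : 0 < p) (hp₁ : p < 1) (hτ : 0 < τ)
    (h_sum : Summable fun i => (m i : ℝ) * (1 + t i) ^ (-τ)) :
    ∃ E, IsExceptional E ∧ ∀ s, 1 < s → s ∉ E → ∀ F : Finset ι, (∀ i ∈ F, t i ≤ 4 * s) →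
      ∑ i ∈ F, (m i : ℝ) * |s - t i|⁻¹ ≤ s ^ (τ / p - 1) := by
  obtain ⟨E, hE, hE_le⟩ :=
    exists_isExceptional_sum_rpow_le (fun i => Nat.cast_nonneg (m i)) ht hp₀ hp₁ hτ h_sum
  refine ⟨E, hE, fun s hs hsE F hF => ?_⟩
  have h_nonneg : ∀ i, 0 ≤ (m i : ℝ) * |s - t i|⁻¹ := fun i => by positivity
  have h_nat : ∀ n : ℕ, (n : ℝ) ^ p ≤ n := fun n => by
    rcases n.eq_zero_or_pos with rfl | hn
    · simp [zero_rpow hp₀.ne']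
    · exact rpow_le_self_of_one_le (by exact_mod_cast hn) hp₁.le
  have h_pow : (∑ i ∈ F, (m i : ℝ) * |s - t i|⁻¹) ^ p ≤ s ^ (τ - p) := by
    refine (rpow_sum_le_sum_rpow F h_nonneg hp₀ hp₁.le).trans
      ((Finset.sum_le_sum fun i _ => ?_).trans (hE_le s hs hsE F hF))
    rw [mul_rpow (by positivity) (by positivity), inv_rpow (abs_nonneg _),
      ← rpow_neg (abs_nonneg _)]
    gcongr
    exact h_nat (m i)
  have h_exp : τ / p - 1 = (τ - p) * p⁻¹ := by field_simp
  rw [h_exp, rpow_mul (by linarith)]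
  exact (le_rpow_inv_iff_of_pos (Finset.sum_nonneg fun i _ => h_nonneg i) (by positivity) hp₀).2
    h_pow

lemma exists_isExceptional_sum_inv_le {ι : Type*} {m : ι → ℕ} {t : ι → ℝ} (ht : ∀ i, 0 ≤ t i)
    {p τ : ℝ} (hp₀ : 0 < p) (hp₁ : p < 1) (hτ : 0 < τ)
    (h_sum : Summable fun i => (m i : ℝ) * (1 + t i) ^ (-τ)) :
    ∃ E, IsExceptional E ∧ ∀ s, 1 < s → s ∉ E → ∀ F : Finset ι, (∀ i ∈ F, t i ≤ 4 * s) →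
      ∑ i ∈ F, (m i : ℝ) * |s - t i|⁻¹ ≤ s ^ (τ / p - 1) := by
  classical
  have h_pos : ∀ i, (1 + t i) ^ (-τ) ≠ 0 := fun i => (rpow_pos_of_pos (by linarith [ht i]) _).ne'
  have : Countable {i // m i ≠ 0} := (h_sum.countable_support.mono fun i hi =>
    mul_ne_zero (Nat.cast_ne_zero.2 hi) (h_pos i)).to_subtype
  obtain ⟨E, hE, hE_le⟩ := exists_isExceptional_sum_inv_le_of_countable
    (m := fun i : {i // m i ≠ 0} => m i) (fun i => ht i) hp₀ hp₁ hτ (h_sum.subtype _)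
  refine ⟨E, hE, fun s hs hsE F hF => ?_⟩
  have h := hE_le s hs hsE (F.subtype fun i => m i ≠ 0)
    fun i hi => hF i (Finset.mem_subtype.1 hi)
  rw [Finset.sum_subtype_eq_sum_filter (fun i => (m i : ℝ) * |s - t i|⁻¹)] at h
  refine (Finset.sum_filter_of_ne fun i _ hi => ?_).symm.trans_le h
  exact fun hi₀ => hi (by simp [hi₀])

end ReciprocalDistances

section CountingSummability

open Real ValueDistribution Function.locallyFinsuppWithin

lemma sum_mul_log_two_le_logCounting {D : Function.locallyFinsupp ℂ ℤ} (hD : 0 ≤ D) {r : ℝ}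
    (hr : 1 ≤ r) {F : Finset ℂ} (hF : ∀ a ∈ F, ‖a‖ ≤ r) :
    (∑ a ∈ F, (D a : ℝ)) * log 2 ≤ logCounting D (2 * r) := by
  classical
  have h_le : ∑ a ∈ F, single a (D a) ≤ D := fun z => by
    simp only [coe_sum, Finset.sum_apply, single_apply]
    rw [Finset.sum_ite_eq F z]
    split_ifs
    exacts [le_rfl, hD z]
  refine le_trans ?_ (logCounting_le h_le (by linarith : 1 ≤ 2 * r))
  rw [map_sum, Finset.sum_apply, Finset.sum_mul]
  refine Finset.sum_le_sum fun a ha => ?_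
  rw [logCounting_single_eq_log_sub_const (by linarith [hF a ha])]
  refine mul_le_mul_of_nonneg_left ?_ (by exact_mod_cast hD a)
  rw [log_mul (by norm_num) (by linarith)]
  rcases eq_or_ne a 0 with rfl | h
  · simpa using log_nonneg hr
  · linarith [log_le_log (norm_pos_iff.2 h) (hF a ha)]

lemma exists_sum_le_of_logCounting_le {D : Function.locallyFinsupp ℂ ℤ} (hD : 0 ≤ D) {K s : ℝ}
    (hK : 0 ≤ K) (hs : 0 ≤ s) (hN : ∀ᶠ r in atTop, logCounting D r ≤ K * r ^ s) :
    ∃ C : ℝ, ∀ (k : ℕ) (F : Finset ℂ), (∀ a ∈ F, ‖a‖ ≤ k) →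
      ∑ a ∈ F, (D a : ℝ) ≤ C * (1 + k) ^ s := by
  obtain ⟨r₀, hr₀⟩ := eventually_atTop.1 hN
  obtain ⟨c, hcr, hc⟩ : ∃ c, r₀ ≤ c ∧ 1 ≤ c := ⟨max r₀ 1, le_max_left _ _, le_max_right _ _⟩
  refine ⟨K * (2 * c) ^ s / log 2, fun k F hF => ?_⟩
  have : (0 : ℝ) ≤ k := Nat.cast_nonneg k
  have h_count := sum_mul_log_two_le_logCounting hD (r := c + k) (by linarith)
    (fun a ha => (hF a ha).trans (by linarith))
  have h_pow : (2 * (c + k)) ^ s ≤ (2 * c) ^ s * (1 + k) ^ s := by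
    rw [← mul_rpow (by positivity) (by positivity)]
    exact rpow_le_rpow (by positivity) (by nlinarith) hs
  rw [div_mul_eq_mul_div, le_div_iff₀ (log_pos one_lt_two)]
  calc _ ≤ K * (2 * (c + k)) ^ s := h_count.trans (hr₀ _ (by linarith))
    _ ≤ K * ((2 * c) ^ s * (1 + k) ^ s) := by gcongr
    _ = _ := by ring

lemma one_add_rpow_neg_le {x e : ℝ} (hx : 0 ≤ x) (he : 0 ≤ e) :
    (1 + x) ^ (-e) ≤ 2 ^ e * (1 + ⌈x⌉₊ : ℝ) ^ (-e) := by
  rw [rpow_neg (by positivity), rpow_neg (by positivity), inv_le_iff_one_le_mul₀ (by positivity),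
    mul_right_comm, ← div_eq_mul_inv, one_le_div (by positivity),
    ← mul_rpow (by norm_num) (by positivity)]
  exact rpow_le_rpow (by positivity) (by linarith [Nat.ceil_lt_add_one hx]) he

lemma summable_of_sum_le_rpow {ι : Type*} {m t : ι → ℝ} (hm : ∀ i, 0 ≤ m i) (ht : ∀ i, 0 ≤ t i)
    {C s : ℝ} (hs : 0 ≤ s + 2)
    (h_count : ∀ (k : ℕ) (F : Finset ι), (∀ i ∈ F, t i ≤ k) → ∑ i ∈ F, m i ≤ C * (1 + k) ^ s) :
    Summable fun i => m i * (1 + t i) ^ (-(s + 2)) := by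
  classical
  have h_summable : Summable fun k : ℕ => (1 + k : ℝ) ^ (-2 : ℝ) := by
    simpa [add_comm] using
      (summable_nat_add_iff 1).2 (Real.summable_nat_rpow.2 (by norm_num : (-2 : ℝ) < -1))
  have hC : 0 ≤ C := by simpa using h_count 0 ∅
  refine summable_of_sum_le (c := 2 ^ (s + 2) * C * ∑' k : ℕ, (1 + k : ℝ) ^ (-2 : ℝ))
    (fun i => mul_nonneg (hm i) (rpow_nonneg (by linarith [ht i]) _)) fun F => ?_
  rw [← Finset.sum_fiberwise_of_maps_to fun i hi => Finset.mem_image_of_mem (⌈t ·⌉₊) hi]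
  have h_fiber : ∀ k : ℕ, ∑ i ∈ F with ⌈t i⌉₊ = k, m i * (1 + t i) ^ (-(s + 2))
      ≤ 2 ^ (s + 2) * C * (1 + k : ℝ) ^ (-2 : ℝ) := fun k => by
    calc ∑ i ∈ F with ⌈t i⌉₊ = k, m i * (1 + t i) ^ (-(s + 2))
        ≤ ∑ i ∈ F with ⌈t i⌉₊ = k, m i * (2 ^ (s + 2) * (1 + k : ℝ) ^ (-(s + 2))) := by
          refine Finset.sum_le_sum fun i hi => mul_le_mul_of_nonneg_left ?_ (hm i)
          exact (Finset.mem_filter.1 hi).2 ▸ one_add_rpow_neg_le (ht i) hs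
      _ ≤ C * (1 + k) ^ s * (2 ^ (s + 2) * (1 + k : ℝ) ^ (-(s + 2))) := by
          rw [← Finset.sum_mul]
          gcongr
          exact h_count k _ fun i hi => (Finset.mem_filter.1 hi).2 ▸ Nat.le_ceil _
      _ = 2 ^ (s + 2) * C * ((1 + k) ^ s * (1 + k : ℝ) ^ (-(s + 2))) := by ring
      _ = 2 ^ (s + 2) * C * (1 + k : ℝ) ^ (-2 : ℝ) := by
          rw [← rpow_add (by positivity), neg_add, add_neg_cancel_left]
  refine (Finset.sum_le_sum fun k _ => h_fiber k).trans ?_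
  rw [← Finset.mul_sum]
  gcongr
  exact h_summable.sum_le_tsum _ fun k _ => by positivity

lemma summable_of_logCounting_le {D : Function.locallyFinsupp ℂ ℤ} (hD : 0 ≤ D) {K s : ℝ}
    (hK : 0 ≤ K) (hs : 0 ≤ s) (hN : ∀ᶠ r in atTop, logCounting D r ≤ K * r ^ s) :
    Summable fun a : ℂ => (D a : ℝ) * (1 + ‖a‖) ^ (-(s + 2)) := by
  obtain ⟨C, h_count⟩ := exists_sum_le_of_logCounting_le hD hK hs hN
  exact summable_of_sum_le_rpow (fun a => by exact_mod_cast hD a) norm_nonneg (by linarith) h_count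

lemma sum_le_of_summable {ι : Type*} {m t : ι → ℝ} (hm : ∀ i, 0 ≤ m i) (ht : ∀ i, 0 ≤ t i)
    {τ R : ℝ} (hτ : 0 ≤ τ) (hR : 0 ≤ R) (h_sum : Summable fun i => m i * (1 + t i) ^ (-τ))
    {F : Finset ι} (hF : ∀ i ∈ F, t i ≤ R) :
    ∑ i ∈ F, m i ≤ (∑' i, m i * (1 + t i) ^ (-τ)) * (1 + R) ^ τ := by
  have h_pos : ∀ i, 0 < 1 + t i := fun i => by linarith [ht i]
  calc ∑ i ∈ F, m i ≤ ∑ i ∈ F, m i * (1 + t i) ^ (-τ) * (1 + R) ^ τ := by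
        refine Finset.sum_le_sum fun i hi => ?_
        rw [mul_assoc]
        refine le_mul_of_one_le_right (hm i) ?_
        rw [rpow_neg (h_pos i).le, inv_mul_eq_div, one_le_div (rpow_pos_of_pos (h_pos i) _)]
        exact rpow_le_rpow (h_pos i).le (by linarith [hF i hi]) hτ
    _ ≤ _ := by
        rw [← Finset.sum_mul]
        gcongr
        exact h_sum.sum_le_tsum _ fun i _ => mul_nonneg (hm i) (rpow_nonneg (h_pos i).le _)

end CountingSummability

section ExponentOfConvergence

open Real

variable {D : Function.locallyFinsupp ℂ ℤ}

lemma exponentOfConvergence_nonneg (D : Function.locallyFinsupp ℂ ℤ) :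
    0 ≤ exponentOfConvergence D := by
  refine le_sInf ?_
  rintro _ ⟨τ, ⟨hτ, _⟩, rfl⟩
  exact EReal.coe_nonneg.2 hτ.le

lemma exists_forall_norm_lt_eq_zero (D : Function.locallyFinsupp ℂ ℤ) :
    ∃ c > 0, ∀ a : ℂ, a ≠ 0 → ‖a‖ < c → D a = 0 := by
  have h : ∀ᶠ a in 𝓝[≠] (0 : ℂ), D a = 0 := by
    rw [compl_eq_univ_sdiff]
    exact D.eq_zero_codiscreteWithin.filter_mono
      (le_iSup₂ (f := fun x (_ : x ∈ univ) => 𝓝[univ \ {x}] x) (0 : ℂ) (mem_univ 0))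
  rw [eventually_nhdsWithin_iff, Metric.eventually_nhds_iff] at h
  obtain ⟨c, hc, h⟩ := h
  exact ⟨c, hc, fun a ha hac => h (by simpa using hac) ha⟩

lemma exponentOfConvergence_le (hD : 0 ≤ D) {τ : ℝ} (hτ : 0 < τ)
    (h_sum : Summable fun a : ℂ => (D a : ℝ) * (1 + ‖a‖) ^ (-τ)) :
    exponentOfConvergence D ≤ τ := by
  refine sInf_le ⟨τ, ⟨hτ, ?_⟩, rfl⟩
  obtain ⟨c, hc, hDc⟩ := exists_forall_norm_lt_eq_zero D
  refine Summable.of_nonneg_of_le (fun a => mul_nonneg (by exact_mod_cast hD _) (by positivity))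
    (fun a => ?_) ((h_sum.subtype {a : ℂ | a ≠ 0}).mul_left (((1 + c) / c) ^ τ))
  have ha : 0 < ‖(a : ℂ)‖ := norm_pos_iff.2 a.2
  rcases lt_or_ge ‖(a : ℂ)‖ c with h | h
  · simp [hDc a a.2 h]
  · have h_ratio : (1 + ‖(a : ℂ)‖) / ‖(a : ℂ)‖ ≤ (1 + c) / c := by
      rw [div_le_div_iff₀ ha hc]
      linarith
    have h_pow : ‖(a : ℂ)‖ ^ (-τ) ≤ ((1 + c) / c) ^ τ * (1 + ‖(a : ℂ)‖) ^ (-τ) := by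
      calc ‖(a : ℂ)‖ ^ (-τ) = ((1 + ‖(a : ℂ)‖) / ‖(a : ℂ)‖) ^ τ * (1 + ‖(a : ℂ)‖) ^ (-τ) := by
            rw [div_rpow (by positivity) ha.le, rpow_neg ha.le, rpow_neg (by positivity)]
            field_simp
        _ ≤ _ := by gcongr
    simp only [Function.comp_apply]
    rw [mul_left_comm]
    exact mul_le_mul_of_nonneg_left h_pow (by exact_mod_cast hD _)

lemma summable_of_exponentOfConvergence_lt (hD : 0 ≤ D) {τ : ℝ}
    (h : exponentOfConvergence D < τ) :
    Summable fun a : ℂ => (D a : ℝ) * (1 + ‖a‖) ^ (-τ) := by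
  obtain ⟨_, ⟨τ', ⟨hτ', h_sum⟩, rfl⟩, h_lt⟩ := sInf_lt_iff.1 h
  have h_lt : τ' < τ := EReal.coe_lt_coe_iff.1 h_lt
  rw [← (finite_singleton (0 : ℂ)).summable_compl_iff]
  refine Summable.of_nonneg_of_le (fun a => mul_nonneg (by exact_mod_cast hD _) (by positivity))
    (fun a => mul_le_mul_of_nonneg_left ?_ (by exact_mod_cast hD _)) h_sum
  have ha : 0 < ‖(a : ℂ)‖ := norm_pos_iff.2 a.2
  calc (1 + ‖(a : ℂ)‖) ^ (-τ) ≤ (1 + ‖(a : ℂ)‖) ^ (-τ') :=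
        rpow_le_rpow_of_exponent_le (by linarith) (by linarith)
    _ ≤ ‖(a : ℂ)‖ ^ (-τ') := rpow_le_rpow_of_nonpos ha (by linarith) (by linarith)

end ExponentOfConvergence

section Growth

open Real ValueDistribution MeromorphicOn

lemma order_nonneg (f : ℂ → ℂ) : 0 ≤ order f := by
  refine le_limsup_of_frequently_le' (Eventually.frequently ?_)
  filter_upwards [eventually_ge_atTop 1] with r hr
  exact_mod_cast div_nonneg posLog_nonneg (log_nonneg hr)

variable {f : ℂ → ℂ} {σ : ℝ}

lemma nonneg_of_order_le (hσ : order f ≤ σ) : 0 ≤ σ :=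
  EReal.coe_nonneg.1 ((order_nonneg f).trans hσ)

lemma eventually_characteristic_le_rpow (hσ : order f ≤ σ) {δ : ℝ} (hδ : 0 < δ) :
    ∀ᶠ r in atTop, characteristic f ⊤ r ≤ r ^ (σ + δ) := by
  have h : order f < ((σ + δ : ℝ) : EReal) :=
    hσ.trans_lt (EReal.coe_lt_coe_iff.2 (lt_add_of_pos_right σ hδ))
  filter_upwards [eventually_lt_of_limsup_lt h, eventually_gt_atTop 1] with r hr hr₁
  have h_log : posLog (characteristic f ⊤ r) < (σ + δ) * log r := by
    rwa [EReal.coe_lt_coe_iff, div_lt_iff₀ (log_pos hr₁)] at hr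
  rcases le_or_gt (characteristic f ⊤ r) 0 with hT | hT
  · exact hT.trans (by positivity)
  · rw [← log_le_log_iff hT (by positivity), log_rpow (by positivity)]
    exact (le_max_right _ _).trans h_log.le

lemma exists_characteristic_inv_le (hf : Meromorphic f) :
    ∃ C : ℝ, 0 ≤ C ∧ ∀ r, characteristic f⁻¹ ⊤ r ≤ characteristic f ⊤ r + C :=
  ⟨_, (abs_nonneg _).trans (le_max_left _ _), fun _ =>
    sub_le_iff_le_add'.1 (abs_sub_le_iff.1 (characteristic_sub_characteristic_inv_le hf)).2⟩

lemma exists_eventually_characteristic_le (hf : Meromorphic f) (hσ : order f ≤ σ) {δ : ℝ}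
    (hδ : 0 < δ) : ∃ K : ℝ, 0 ≤ K ∧ ∀ᶠ r in atTop,
      characteristic f ⊤ r ≤ K * r ^ (σ + δ) ∧ characteristic f⁻¹ ⊤ r ≤ K * r ^ (σ + δ) := by
  obtain ⟨C, hC, h_inv⟩ := exists_characteristic_inv_le hf
  refine ⟨1 + C, by linarith, ?_⟩
  filter_upwards [eventually_characteristic_le_rpow hσ hδ, eventually_ge_atTop 1] with r hr hr₁
  have h_one : 1 ≤ r ^ (σ + δ) := one_le_rpow hr₁ (by linarith [nonneg_of_order_le hσ])
  constructor <;> nlinarith [h_inv r]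

/-- The exponent `λ` of the paper: the larger of the exponents of convergence of the zeros and of
the poles of `f`, as a real number (junk value `0` if it is infinite). -/
noncomputable def zerosPolesExponent (f : ℂ → ℂ) : ℝ :=
  (max (zerosExponent f) (polesExponent f)).toReal

lemma max_zerosExponent_polesExponent_nonneg (f : ℂ → ℂ) :
    0 ≤ max (zerosExponent f) (polesExponent f) :=
  le_max_of_le_left (exponentOfConvergence_nonneg _)

lemma zerosPolesExponent_nonneg (f : ℂ → ℂ) : 0 ≤ zerosPolesExponent f :=
  EReal.toReal_nonneg (max_zerosExponent_polesExponent_nonneg f)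

lemma max_zerosExponent_polesExponent_lt_top (hf : Meromorphic f) (hσ : order f ≤ σ) :
    max (zerosExponent f) (polesExponent f) < ⊤ := by
  obtain ⟨K, hK, h⟩ := exists_eventually_characteristic_le hf hσ one_pos
  have hσ₀ := nonneg_of_order_le hσ
  have h_lt_top : ∀ D : Function.locallyFinsupp ℂ ℤ, 0 ≤ D →
      (∀ᶠ r in atTop, Function.locallyFinsuppWithin.logCounting D r ≤ K * r ^ (σ + 1)) →
      exponentOfConvergence D < ⊤ := fun D hD hN =>
    (exponentOfConvergence_le hD (by linarith)
      (summable_of_logCounting_le hD hK (by linarith) hN)).trans_lt (EReal.coe_lt_top _)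
  refine max_lt (h_lt_top _ (posPart_nonneg _) ?_) (h_lt_top _ (negPart_nonneg _) ?_)
  · filter_upwards [h] with r hr
    rw [← logCounting_zero, ← logCounting_inv]
    exact (le_add_of_nonneg_left (proximity_nonneg r)).trans hr.2
  · filter_upwards [h] with r hr
    rw [← logCounting_top]
    exact (le_add_of_nonneg_left (proximity_nonneg r)).trans hr.1

lemma coe_zerosPolesExponent (hf : Meromorphic f) (hσ : order f ≤ σ) :
    (zerosPolesExponent f : EReal) = max (zerosExponent f) (polesExponent f) :=
  EReal.coe_toReal (max_zerosExponent_polesExponent_lt_top hf hσ).ne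
    (EReal.bot_lt_zero.trans_le (max_zerosExponent_polesExponent_nonneg f)).ne'

lemma summable_natAbs_divisor (hf : Meromorphic f) (hσ : order f ≤ σ) {τ : ℝ}
    (hτ : zerosPolesExponent f < τ) :
    Summable fun a : ℂ => ((divisor f univ a).natAbs : ℝ) * (1 + ‖a‖) ^ (-τ) := by
  have h_lt : max (zerosExponent f) (polesExponent f) < (τ : EReal) := by
    rw [← coe_zerosPolesExponent hf hσ]
    exact_mod_cast hτ
  have h_zeros := summable_of_exponentOfConvergence_lt (posPart_nonneg _)
    ((le_max_left _ _).trans_lt h_lt)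
  have h_poles := summable_of_exponentOfConvergence_lt (negPart_nonneg _)
    ((le_max_right _ _).trans_lt h_lt)
  refine (h_zeros.add h_poles).congr fun a => ?_
  rw [← add_mul, Function.locallyFinsuppWithin.posPart_apply,
    Function.locallyFinsuppWithin.negPart_apply, ← Int.cast_add, posPart_add_negPart,
    Nat.cast_natAbs]

lemma exists_sum_natAbs_divisor_mul_log_le (hf : Meromorphic f) (hσ : order f ≤ σ) {ε : ℝ}
    (hε : 0 < ε) :
    ∃ B : ℝ, 0 ≤ B ∧ ∀ R, 1 ≤ R → ∀ F : Finset ℂ, (∀ a ∈ F, ‖a‖ ≤ R) →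
      (∑ a ∈ F, ((divisor f univ a).natAbs : ℝ)) * log (4 * R)
        ≤ B * R ^ (zerosPolesExponent f + ε) := by
  obtain ⟨τ, hτ⟩ : ∃ τ, τ = zerosPolesExponent f + ε / 2 := ⟨_, rfl⟩
  have hτ₀ : 0 ≤ τ := by linarith [zerosPolesExponent_nonneg f]
  have h_sum := summable_natAbs_divisor hf hσ (hτ ▸ lt_add_of_pos_right _ (half_pos hε))
  set C := ∑' a : ℂ, ((divisor f univ a).natAbs : ℝ) * (1 + ‖a‖) ^ (-τ)
  have : 0 ≤ C := tsum_nonneg fun a => by positivity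
  refine ⟨C * 2 ^ τ * (4 ^ (ε / 2) / (ε / 2)), by positivity, fun R hR F hF => ?_⟩
  have hR₀ : 0 < R := by linarith
  have h_count : ∑ a ∈ F, ((divisor f univ a).natAbs : ℝ) ≤ C * (2 ^ τ * R ^ τ) := by
    refine (sum_le_of_summable (fun a => Nat.cast_nonneg _) norm_nonneg hτ₀ hR₀.le
      h_sum hF).trans ?_
    rw [← mul_rpow (by norm_num) hR₀.le]
    gcongr
    linarith
  have h_log : log (4 * R) ≤ 4 ^ (ε / 2) / (ε / 2) * R ^ (ε / 2) := by
    have := log_le_rpow_div (by positivity : 0 ≤ 4 * R) (half_pos hε)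
    rwa [mul_rpow (by norm_num) hR₀.le, mul_div_right_comm] at this
  calc _ ≤ C * (2 ^ τ * R ^ τ) * (4 ^ (ε / 2) / (ε / 2) * R ^ (ε / 2)) :=
        mul_le_mul h_count h_log (log_nonneg (by linarith)) (by positivity)
    _ = C * 2 ^ τ * (4 ^ (ε / 2) / (ε / 2)) * (R ^ τ * R ^ (ε / 2)) := by ring
    _ = C * 2 ^ τ * (4 ^ (ε / 2) / (ε / 2)) * R ^ (zerosPolesExponent f + ε) := by
        rw [← rpow_add hR₀, hτ, add_assoc, add_halves]

end Growth

section Factorization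

open Real ValueDistribution MeromorphicOn Metric

/-- `z` is neither a zero nor a pole of `f`, and `f` takes the right value at `z` if `z` is a
removable singularity. -/
def IsRegularAt (f : ℂ → ℂ) (z : ℂ) : Prop :=
  AnalyticAt ℂ f z ∧ f z ≠ 0

/-- On the disk `‖z‖ ≤ R`, outside a discrete set, `f` is the product of the rational function
`∏ a ∈ F, (z - a) ^ D a` and a zero-free analytic function `g`. -/
structure IsDiskFactorization (f : ℂ → ℂ) (D : ℂ → ℤ) (R : ℝ) (F : Finset ℂ) (g : ℂ → ℂ) :
    Prop where
  norm_le : ∀ a ∈ F, ‖a‖ ≤ R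
  exponent_ne_zero : ∀ a ∈ F, D a ≠ 0
  analyticOnNhd : AnalyticOnNhd ℂ g (closedBall 0 R)
  ne_zero : ∀ z ∈ closedBall 0 R, g z ≠ 0
  eventuallyEq : f =ᶠ[codiscreteWithin (closedBall 0 R)] fun z => (∏ a ∈ F, (z - a) ^ D a) * g z

/-- The deviation of the logarithm of `∏ a ∈ F, ((z + η - a) / (z - a)) ^ D a` from its first-order
approximation `η * ∑ a ∈ F, D a / (z - a)`. -/
noncomputable def zerosPolesRemainder (F : Finset ℂ) (D : ℂ → ℤ) (η z : ℂ) : ℂ :=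
  ∑ a ∈ F, D a * logRemainder (η / (z - a))

variable {f g : ℂ → ℂ} {F : Finset ℂ} {D : ℂ → ℤ} {R : ℝ}

lemma meromorphicOrderAt_ne_top_of_not_eventuallyEq_zero (hf : Meromorphic f)
    (hf0 : ¬ f =ᶠ[codiscrete ℂ] 0) (z : ℂ) : meromorphicOrderAt f z ≠ ⊤ := by
  intro hz
  refine hf0 (mem_codiscrete.2 fun x => ?_)
  have hx : meromorphicOrderAt f x = ⊤ := by
    by_contra hx
    exact hf.meromorphicOn.meromorphicOrderAt_ne_top_of_isPreconnected isPreconnected_univ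
      (mem_univ x) (mem_univ z) hx hz
  rw [disjoint_principal_right, compl_compl]
  filter_upwards [meromorphicOrderAt_eq_top_iff.1 hx] with w hw
  simpa using hw

lemma countable_compl_isRegularAt (hf : Meromorphic f) (h_order : ∀ z, meromorphicOrderAt f z ≠ ⊤) :
    {z | IsRegularAt f z}ᶜ.Countable := by
  rw [← inter_univ {z | IsRegularAt f z}ᶜ]
  refine (HereditarilyLindelofSpace.isLindelof _).countable_of_isDiscrete
    (isDiscrete_of_codiscreteWithin ?_)
  rw [compl_compl]
  exact (hf.meromorphicOn.eventually_codiscreteWithin_analyticAt f).and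
    (hf.meromorphicOn.eventually_codiscreteWithin_apply_ne_zero fun x _ => h_order x)

lemma IsRegularAt.divisor_eq_zero (hf : Meromorphic f) {z : ℂ} (hz : IsRegularAt f z) :
    divisor f univ z = 0 := by
  rw [divisor_apply hf.meromorphicOn (mem_univ z), hz.1.meromorphicOrderAt_eq,
    hz.1.analyticOrderAt_eq_zero.2 hz.2]
  simp

lemma exists_isDiskFactorization (hf : Meromorphic f) (h_order : ∀ z, meromorphicOrderAt f z ≠ ⊤)
    (R : ℝ) : ∃ F g, IsDiskFactorization f (divisor f univ) R F g := by
  have h_finite := (divisor f (closedBall (0 : ℂ) R)).finiteSupport (isCompact_closedBall 0 R)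
  have h_mem : ∀ a ∈ h_finite.toFinset, a ∈ closedBall (0 : ℂ) R := fun a ha =>
    (divisor f (closedBall (0 : ℂ) R)).supportWithinDomain (h_finite.mem_toFinset.1 ha)
  have h_divisor : ∀ a ∈ h_finite.toFinset, divisor f (closedBall 0 R) a = divisor f univ a :=
    fun a ha => by
      rw [divisor_apply hf.meromorphicOn (h_mem a ha), divisor_apply hf.meromorphicOn (mem_univ a)]
  obtain ⟨g, hg, hg0, hfg⟩ := hf.meromorphicOn.extract_zeros_poles (fun u => h_order u) h_finite
  refine ⟨h_finite.toFinset, g, fun a ha => by simpa using h_mem a ha,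
    fun a ha => h_divisor a ha ▸ h_finite.mem_toFinset.1 ha, hg, fun z hz => hg0 ⟨z, hz⟩, ?_⟩
  filter_upwards [hfg] with z hz
  rw [hz, Pi.smul_apply', smul_eq_mul, Function.FactorizedRational.finprod_eq_fun h_finite]
  beta_reduce
  rw [finprod_eq_prod_of_mulSupport_subset (s := h_finite.toFinset)]
  · exact congrArg (· * g z) (Finset.prod_congr rfl fun a ha => by rw [h_divisor a ha])
  · intro a ha
    rw [h_finite.coe_toFinset]
    exact fun h => ha (by simp [h])

lemma prod_sub_zpow_div_eq_exp {z η : ℂ} (hz : z ∉ F) (hzη : z + η ∉ F) :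
    (∏ a ∈ F, (z + η - a) ^ D a) / (∏ a ∈ F, (z - a) ^ D a)
      = Complex.exp (η * (∑ a ∈ F, D a / (z - a)) + zerosPolesRemainder F D η z) := by
  rw [zerosPolesRemainder, ← Finset.prod_div_distrib, Finset.mul_sum, ← Finset.sum_add_distrib,
    Complex.exp_sum]
  refine Finset.prod_congr rfl fun a ha => ?_
  have hza : z - a ≠ 0 := sub_ne_zero.2 (ne_of_mem_of_not_mem ha hz).symm
  have hzηa : z + η - a ≠ 0 := sub_ne_zero.2 (ne_of_mem_of_not_mem ha hzη).symm
  have h_ratio : 1 + η / (z - a) = (z + η - a) / (z - a) := by field_simp; ring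
  have h_log : η * (D a / (z - a)) + D a * logRemainder (η / (z - a))
      = D a * Complex.log (1 + η / (z - a)) := by rw [logRemainder]; ring
  rw [h_log, Complex.exp_int_mul, h_ratio, Complex.exp_log (div_ne_zero hzηa hza), div_zpow]

namespace IsDiskFactorization

lemma eventuallyEq_nhds (h : IsDiskFactorization f D R F g) {z : ℂ} (hz : AnalyticAt ℂ f z)
    (hzF : z ∉ F) (hzR : ‖z‖ < R) : f =ᶠ[𝓝 z] fun z => (∏ a ∈ F, (z - a) ^ D a) * g z := by
  have h_ball : closedBall (0 : ℂ) R ∈ 𝓝 z := closedBall_mem_nhds_of_mem (by simpa using hzR)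
  have h_continuous : ContinuousAt (fun z => (∏ a ∈ F, (z - a) ^ D a) * g z) z := by
    refine ContinuousAt.mul (tendsto_finsetProd _ fun a ha => ?_)
      (h.analyticOnNhd z (mem_of_mem_nhds h_ball)).continuousAt
    exact ContinuousAt.zpow₀ (by fun_prop) _
      (Or.inl (sub_ne_zero.2 (ne_of_mem_of_not_mem ha hzF).symm))
  rw [← hz.continuousAt.eventuallyEq_nhds_iff_eventuallyEq_nhdsNE h_continuous]
  filter_upwards [mem_codiscreteWithin_iff_forall_mem_nhdsNE.1 h.eventuallyEq z
    (mem_of_mem_nhds h_ball), mem_nhdsWithin_of_mem_nhds h_ball] with w hw hwR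
  exact hw.resolve_right fun h => h hwR

lemma logDeriv_eq (h : IsDiskFactorization f D R F g) {z : ℂ} (hz : AnalyticAt ℂ f z)
    (hzF : z ∉ F) (hzR : ‖z‖ < R) :
    logDeriv f z = (∑ a ∈ F, D a / (z - a)) + logDeriv g z := by
  have hz_mem : z ∈ closedBall (0 : ℂ) R := by simpa using hzR.le
  have h_sub : ∀ a ∈ F, z - a ≠ 0 := fun a ha => sub_ne_zero.2 (ne_of_mem_of_not_mem ha hzF).symm
  have h_ne_zero : ∀ a ∈ F, (z - a) ^ D a ≠ 0 := fun a ha => zpow_ne_zero _ (h_sub a ha)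
  have h_diff : ∀ a ∈ F, DifferentiableAt ℂ (fun z => (z - a) ^ D a) z := fun a ha =>
    DifferentiableAt.zpow (by fun_prop) (Or.inl (h_sub a ha))
  have h_factor : ∀ a ∈ F, logDeriv (fun z => (z - a) ^ D a) z = D a / (z - a) := fun a _ => by
    rw [logDeriv_fun_zpow (by fun_prop), logDeriv_apply]
    simp [div_eq_mul_inv]
  rw [(logDeriv_congr_nhds (h.eventuallyEq_nhds hz hzF hzR)).self_of_nhds,
    logDeriv_mul z (Finset.prod_ne_zero_iff.2 h_ne_zero) (h.ne_zero z hz_mem)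
      (DifferentiableAt.fun_finsetProd h_diff) (h.analyticOnNhd z hz_mem).differentiableAt,
    logDeriv_prod (f := fun a z => (z - a) ^ D a) h_ne_zero h_diff, Finset.sum_congr rfl h_factor]

lemma exists_quotient_eq_exp (h : IsDiskFactorization f D R F g) {z η : ℂ} (hz : AnalyticAt ℂ f z)
    (hzη : AnalyticAt ℂ f (z + η)) (hzF : z ∉ F) (hzηF : z + η ∉ F) (hR : ‖z‖ + ‖η‖ < R) :
    ∃ ρ : ℂ, f (z + η) / f z
        = Complex.exp (η * logDeriv f z + (zerosPolesRemainder F D η z + ρ)) ∧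
      ‖ρ‖ ≤ 2 * R * ‖η‖ ^ 2 / ((R - ‖z‖) ^ 2 * (R - ‖z‖ - ‖η‖))
        * circleAverage (fun ζ => |log ‖g ζ‖|) 0 R := by
  have hzR : ‖z‖ < R := by linarith [norm_nonneg η]
  have hzηR : ‖z + η‖ < R := (norm_add_le z η).trans_lt hR
  obtain ⟨ρ, hρ, hρ_le⟩ := exists_quotient_eq_exp_of_ne_zero h.analyticOnNhd h.ne_zero hR
  refine ⟨ρ, ?_, hρ_le⟩
  rw [h.logDeriv_eq hz hzF hzR, (h.eventuallyEq_nhds hz hzF hzR).eq_of_nhds,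
    (h.eventuallyEq_nhds hzη hzηF hzηR).eq_of_nhds, mul_div_mul_comm,
    prod_sub_zpow_div_eq_exp hzF hzηF, hρ, ← Complex.exp_add]
  congr 1
  ring

lemma log_norm_eventuallyEq (h : IsDiskFactorization f D R F g) :
    (fun z => log ‖g z‖) =ᶠ[codiscreteWithin (sphere 0 R)]
      fun z => log ‖f z‖ - ∑ a ∈ F, D a * log ‖z - a‖ := by
  filter_upwards [h.eventuallyEq.filter_mono (codiscreteWithin_mono sphere_subset_closedBall),
    compl_finite_mem_codiscreteWithin (s := sphere 0 R) F.finite_toSet,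
    self_mem_codiscreteWithin (sphere (0 : ℂ) R)] with z hz hzF hzR
  have h_ne_zero : ∀ a ∈ F, ‖z - a‖ ^ D a ≠ 0 := fun a ha =>
    zpow_ne_zero _ (norm_ne_zero_iff.2 (sub_ne_zero.2 (ne_of_mem_of_not_mem ha hzF).symm))
  have hgz := norm_ne_zero_iff.2 (h.ne_zero z (sphere_subset_closedBall hzR))
  simp only [hz, norm_mul, norm_prod, norm_zpow]
  rw [log_mul (Finset.prod_ne_zero_iff.2 h_ne_zero) hgz, log_prod h_ne_zero]
  simp only [log_zpow, add_sub_cancel_left]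

end IsDiskFactorization

lemma abs_log_le_of_abs_le {x b : ℝ} (hb : 1 ≤ b) (hx : |x| ≤ b) :
    |log x| ≤ 2 * log b - log x := by
  have hb_log := log_nonneg hb
  have h_le : log x ≤ log b := by
    rcases eq_or_ne x 0 with rfl | h
    · simpa using hb_log
    · exact log_abs x ▸ log_le_log (abs_pos.2 h) hx
  rw [abs_le]
  constructor <;> linarith

lemma circleAverage_abs_log_norm_sub_le {a : ℂ} (hR : 1 ≤ R) (ha : ‖a‖ ≤ R) :
    circleAverage (fun z => |log ‖z - a‖|) 0 R ≤ log (4 * R) := by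
  have hR₀ : 0 < R := by linarith
  have h_log : CircleIntegrable (fun z : ℂ => log ‖z - a‖) 0 R :=
    circleIntegrable_log_norm_sub_const R
  have h_const : CircleIntegrable (fun _ : ℂ => 2 * log (2 * R)) 0 R := circleIntegrable_const _ _ _
  calc circleAverage (fun z => |log ‖z - a‖|) 0 R
      ≤ circleAverage (fun z => 2 * log (2 * R) - log ‖z - a‖) 0 R := by
        refine circleAverage_mono h_log.abs (h_const.sub h_log) fun z hz => ?_
        rw [abs_of_pos hR₀, mem_sphere_zero_iff_norm] at hz
        exact abs_log_le_of_abs_le (by linarith) (by rw [abs_norm]; linarith [norm_sub_le z a])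
    _ = 2 * log (2 * R) - log R := by
        rw [circleAverage_fun_sub h_const h_log, circleAverage_const,
          circleAverage_log_norm_sub_const_of_mem_closedBall
            (by simpa using ha.trans (le_abs_self R))]
    _ = log (4 * R) := by
        rw [show 4 * R = 2 * (2 * R) by ring, log_mul two_ne_zero (y := 2 * R) (by positivity),
          log_mul two_ne_zero hR₀.ne']
        ring

lemma circleAverage_abs_log_norm (hf : Meromorphic f) :
    circleAverage (fun z => |log ‖f z‖|) 0 R = proximity f ⊤ R + proximity f⁻¹ ⊤ R := by
  rw [proximity_top, proximity_top, ← circleAverage_fun_add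
    hf.meromorphicOn.circleIntegrable_posLog_norm hf.inv.meromorphicOn.circleIntegrable_posLog_norm]
  congr 1
  ext z
  rw [Pi.inv_apply, norm_inv, posLog_apply, posLog_apply, log_inv, max_comm 0, max_comm 0]
  exact (posPart_add_negPart (log ‖f z‖)).symm

lemma IsDiskFactorization.circleAverage_abs_log_norm_le (h : IsDiskFactorization f D R F g)
    (hf : Meromorphic f) (hR : 1 ≤ R) :
    circleAverage (fun z => |log ‖g z‖|) 0 R
      ≤ proximity f ⊤ R + proximity f⁻¹ ⊤ R
        + (∑ a ∈ F, ((D a).natAbs : ℝ)) * log (4 * R) := by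
  have hR₀ : 0 < R := by linarith
  have h_log : ∀ a, CircleIntegrable (fun z : ℂ => log ‖z - a‖) 0 R := fun a =>
    circleIntegrable_log_norm_sub_const R
  have h_log_f : CircleIntegrable (fun z => log ‖f z‖) 0 R :=
    hf.meromorphicOn.circleIntegrable_log_norm
  have h_sum : CircleIntegrable (fun z => ∑ a ∈ F, (D a : ℝ) * log ‖z - a‖) 0 R :=
    CircleIntegrable.fun_sum F fun a _ => (h_log a).const_mul _
  have h_abs : ∀ a ∈ F, CircleIntegrable (fun z => ((D a).natAbs : ℝ) * |log ‖z - a‖|) 0 R :=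
    fun a _ => (h_log a).abs.const_mul _
  calc circleAverage (fun z => |log ‖g z‖|) 0 R
      = circleAverage (fun z => |log ‖f z‖ - ∑ a ∈ F, D a * log ‖z - a‖|) 0 R :=
        circleAverage_congr_codiscreteWithin
          (by rw [abs_of_pos hR₀]; exact h.log_norm_eventuallyEq.fun_comp abs) hR₀.ne'
    _ ≤ circleAverage (fun z => |log ‖f z‖| + ∑ a ∈ F, ((D a).natAbs : ℝ) * |log ‖z - a‖|) 0 R := by
        refine circleAverage_mono (h_log_f.sub h_sum).abs
          (h_log_f.abs.add (CircleIntegrable.fun_sum F h_abs)) fun z _ => ?_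
        refine (abs_sub _ _).trans (add_le_add le_rfl ?_)
        refine (Finset.abs_sum_le_sum_abs _ _).trans_eq (Finset.sum_congr rfl fun a _ => ?_)
        rw [abs_mul, Nat.cast_natAbs, Int.cast_abs]
    _ = proximity f ⊤ R + proximity f⁻¹ ⊤ R +
          ∑ a ∈ F, ((D a).natAbs : ℝ) * circleAverage (fun z => |log ‖z - a‖|) 0 R := by
        rw [circleAverage_fun_add (f₁ := fun z => |log ‖f z‖|) h_log_f.abs
          (CircleIntegrable.fun_sum F h_abs), circleAverage_abs_log_norm hf,
          circleAverage_fun_sum h_abs]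
        simp only [← smul_eq_mul, circleAverage_fun_smul]
    _ ≤ _ := by
        rw [Finset.sum_mul]
        gcongr with a ha
        exact circleAverage_abs_log_norm_sub_le hR (h.norm_le a ha)

lemma exists_circleAverage_factor_le (hf : Meromorphic f) {σ : ℝ} (hσ : order f ≤ σ) {ε : ℝ}
    (hε : 0 < ε) :
    ∃ K : ℝ, 0 ≤ K ∧ ∀ᶠ R in atTop, ∀ F g, IsDiskFactorization f (divisor f univ) R F g →
      circleAverage (fun z => |log ‖g z‖|) 0 R
        ≤ K * (R ^ (σ + ε) + R ^ (zerosPolesExponent f + ε)) := by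
  obtain ⟨K, hK, h_char⟩ := exists_eventually_characteristic_le hf hσ hε
  obtain ⟨B, hB, h_count⟩ := exists_sum_natAbs_divisor_mul_log_le hf hσ hε
  refine ⟨2 * K + B, by positivity, ?_⟩
  filter_upwards [h_char, eventually_ge_atTop 1] with R ⟨h_char, h_char_inv⟩ hR F g h
  have h_avg := h.circleAverage_abs_log_norm_le hf hR
  have h_prox : proximity f ⊤ R ≤ K * R ^ (σ + ε) :=
    (le_add_of_nonneg_right (logCounting_nonneg hR)).trans h_char
  have h_prox_inv : proximity f⁻¹ ⊤ R ≤ K * R ^ (σ + ε) :=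
    (le_add_of_nonneg_right (logCounting_nonneg hR)).trans h_char_inv
  have : 0 ≤ B * R ^ (σ + ε) := by positivity
  have : 0 ≤ K * R ^ (zerosPolesExponent f + ε) := by positivity
  linarith [h_count R hR F h.norm_le]

end Factorization

section ZerosPolesRemainder

open Real MeromorphicOn

lemma sum_mul_pow_le_pow_sum {ι : Type*} (F : Finset ι) (m : ι → ℕ) {x : ι → ℝ}
    (hx : ∀ i, 0 ≤ x i) {k : ℕ} (hk : 1 ≤ k) :
    ∑ i ∈ F, (m i : ℝ) * x i ^ k ≤ (∑ i ∈ F, (m i : ℝ) * x i) ^ k := by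
  have h_nonneg : ∀ i, 0 ≤ (m i : ℝ) * x i := fun i => mul_nonneg (Nat.cast_nonneg _) (hx i)
  obtain ⟨j, rfl⟩ := Nat.exists_eq_add_of_le' hk
  rw [pow_succ', Finset.sum_mul]
  refine Finset.sum_le_sum fun i hi => ?_
  have h_single := Finset.single_le_sum (fun i _ => h_nonneg i) hi
  rcases Nat.eq_zero_or_pos (m i) with hm | hm
  · simp [hm]
  · rw [pow_succ', ← mul_assoc]
    have h_le : x i ≤ ∑ i ∈ F, (m i : ℝ) * x i :=
      (le_mul_of_one_le_left (hx i) (by exact_mod_cast hm)).trans h_single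
    exact mul_le_mul_of_nonneg_left (pow_le_pow_left₀ (hx i) h_le j) (h_nonneg i)

lemma norm_div_sub_le {η z a : ℂ} (h : ‖z‖ ≠ ‖a‖) : ‖η / (z - a)‖ ≤ ‖η‖ * |‖z‖ - ‖a‖|⁻¹ := by
  have := abs_pos.2 (sub_ne_zero.2 h)
  rw [norm_div, div_eq_mul_inv]
  gcongr
  exact abs_norm_sub_norm_le z a

lemma norm_logRemainder_div_sub_le {η z a : ℂ} (h₁ : ‖z‖ ≠ ‖a‖) (h₂ : ‖z‖ ≠ ‖a - η‖) {k : ℕ}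
    (hk₁ : 1 ≤ k) (hk₂ : k ≤ 2) :
    ‖logRemainder (η / (z - a))‖
      ≤ 25 * ‖η‖ ^ k * (|‖z‖ - ‖a‖|⁻¹ ^ k + |‖z‖ - ‖a - η‖|⁻¹ ^ k) := by
  have hza : z - a ≠ 0 := sub_ne_zero.2 fun h => h₁ (by rw [h])
  have hzηa : z - (a - η) ≠ 0 := sub_ne_zero.2 fun h => h₂ (by rw [← h])
  have h_ratio : 1 + η / (z - a) = (z - (a - η)) / (z - a) := by field_simp; ring
  have h_div : η / (z - a) / (1 + η / (z - a)) = η / (z - (a - η)) := by rw [h_ratio]; field_simp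
  have h_ne_zero : 1 + η / (z - a) ≠ 0 := h_ratio ▸ div_ne_zero hzηa hza
  calc ‖logRemainder (η / (z - a))‖
      ≤ 25 * (‖η / (z - a)‖ ^ k + ‖η / (z - (a - η))‖ ^ k) :=
        h_div ▸ norm_logRemainder_le_pow h_ne_zero hk₁ hk₂
    _ ≤ 25 * ((‖η‖ * |‖z‖ - ‖a‖|⁻¹) ^ k + (‖η‖ * |‖z‖ - ‖a - η‖|⁻¹) ^ k) := by
        gcongr
        exacts [norm_div_sub_le h₁, norm_div_sub_le h₂]
    _ = _ := by rw [mul_pow, mul_pow]; ring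

lemma norm_zerosPolesRemainder_le {F : Finset ℂ} {D : ℂ → ℤ} {z η : ℂ} {s : ℝ} {k : ℕ}
    (hk₁ : 1 ≤ k) (hk₂ : k ≤ 2) (h₁ : ∀ a ∈ F, ‖z‖ ≠ ‖a‖) (h₂ : ∀ a ∈ F, ‖z‖ ≠ ‖a - η‖)
    (hs₁ : ∑ a ∈ F, ((D a).natAbs : ℝ) * |‖z‖ - ‖a‖|⁻¹ ≤ s)
    (hs₂ : ∑ a ∈ F, ((D a).natAbs : ℝ) * |‖z‖ - ‖a - η‖|⁻¹ ≤ s) :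
    ‖zerosPolesRemainder F D η z‖ ≤ 50 * ‖η‖ ^ k * s ^ k := by
  have h_pow : ∀ t : ℂ → ℝ, ∑ a ∈ F, ((D a).natAbs : ℝ) * |‖z‖ - t a|⁻¹ ≤ s →
      ∑ a ∈ F, ((D a).natAbs : ℝ) * |‖z‖ - t a|⁻¹ ^ k ≤ s ^ k := fun t h =>
    (sum_mul_pow_le_pow_sum F _ (fun a => by positivity) hk₁).trans
      (pow_le_pow_left₀ (Finset.sum_nonneg fun a _ => by positivity) h k)
  calc ‖zerosPolesRemainder F D η z‖
      ≤ ∑ a ∈ F, ((D a).natAbs : ℝ) * ‖logRemainder (η / (z - a))‖ := by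
        refine (norm_sum_le _ _).trans_eq (Finset.sum_congr rfl fun a _ => ?_)
        rw [norm_mul, Complex.norm_intCast, Nat.cast_natAbs, Int.cast_abs]
    _ ≤ ∑ a ∈ F, ((D a).natAbs : ℝ) *
          (25 * ‖η‖ ^ k * (|‖z‖ - ‖a‖|⁻¹ ^ k + |‖z‖ - ‖a - η‖|⁻¹ ^ k)) := by
        gcongr with a ha
        exact norm_logRemainder_div_sub_le (h₁ a ha) (h₂ a ha) hk₁ hk₂
    _ = 25 * ‖η‖ ^ k * (∑ a ∈ F, ((D a).natAbs : ℝ) * |‖z‖ - ‖a‖|⁻¹ ^ k +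
          ∑ a ∈ F, ((D a).natAbs : ℝ) * |‖z‖ - ‖a - η‖|⁻¹ ^ k) := by
        rw [← Finset.sum_add_distrib, Finset.mul_sum]
        exact Finset.sum_congr rfl fun a _ => by ring
    _ ≤ 25 * ‖η‖ ^ k * (s ^ k + s ^ k) := by
        gcongr
        exacts [h_pow _ hs₁, h_pow _ hs₂]
    _ = 50 * ‖η‖ ^ k * s ^ k := by ring

lemma sub_two_le_beta (σ lam : ℝ) : σ - 2 ≤ beta σ lam := by
  rw [beta]
  split_ifs <;> exact le_max_left _ _

lemma exponent_sub_two_le_beta (σ : ℝ) {lam : ℝ} (h : 0 ≤ lam) : lam - 2 ≤ beta σ lam := by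
  rw [beta]
  split_ifs <;> exact le_max_of_le_right (by linarith)

/- The two cases of `beta` are the two ways to estimate a single zero or pole: quadratically in its
reciprocal distance (`k = 2`) if `lam < 1`, and linearly (`k = 1`) otherwise. -/
lemma exists_nat_mul_sub_one_le_beta (σ lam : ℝ) :
    ∃ k : ℕ, 1 ≤ k ∧ k ≤ 2 ∧ k * (lam - 1) ≤ beta σ lam := by
  rw [beta]
  split_ifs
  · exact ⟨2, one_le_two, le_rfl, le_max_of_le_right (by push_cast; linarith)⟩
  · exact ⟨1, le_rfl, one_le_two, le_max_of_le_right (by push_cast; linarith)⟩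

lemma exists_norm_zerosPolesRemainder_le (η : ℂ) (σ lam : ℝ) {ε : ℝ} (hε : 0 < ε) :
    ∃ K : ℝ, ∀ (F : Finset ℂ) (D : ℂ → ℤ) (z : ℂ), 1 ≤ ‖z‖ → (∀ a ∈ F, ‖z‖ ≠ ‖a‖) →
      (∀ a ∈ F, ‖z‖ ≠ ‖a - η‖) →
      ∑ a ∈ F, ((D a).natAbs : ℝ) * |‖z‖ - ‖a‖|⁻¹ ≤ ‖z‖ ^ (lam + ε / 2 - 1) →
      ∑ a ∈ F, ((D a).natAbs : ℝ) * |‖z‖ - ‖a - η‖|⁻¹ ≤ ‖z‖ ^ (lam + ε / 2 - 1) →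
      ‖zerosPolesRemainder F D η z‖ ≤ K * ‖z‖ ^ (beta σ lam + ε) := by
  obtain ⟨k, hk₁, hk₂, hk⟩ := exists_nat_mul_sub_one_le_beta σ lam
  refine ⟨50 * ‖η‖ ^ k, fun F D z hz h₁ h₂ hs₁ hs₂ => ?_⟩
  refine (norm_zerosPolesRemainder_le hk₁ hk₂ h₁ h₂ hs₁ hs₂).trans ?_
  gcongr
  rw [← rpow_mul_natCast (norm_nonneg z)]
  have : (k : ℝ) ≤ 2 := by exact_mod_cast hk₂
  exact rpow_le_rpow_of_exponent_le hz (by nlinarith)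

end ZerosPolesRemainder

section DifferenceQuotient

open Real MeromorphicOn

variable {f : ℂ → ℂ} {σ ε : ℝ}

lemma summable_mul_one_add_norm_sub_rpow {E : Type*} [SeminormedAddCommGroup E] {m : E → ℝ}
    (hm : ∀ a, 0 ≤ m a) {τ : ℝ} (hτ : 0 ≤ τ) (h_sum : Summable fun a => m a * (1 + ‖a‖) ^ (-τ))
    (b : E) : Summable fun a => m a * (1 + ‖a - b‖) ^ (-τ) := by
  refine Summable.of_nonneg_of_le (fun a => mul_nonneg (hm a) (by positivity)) (fun a => ?_)
    (h_sum.mul_left ((1 + ‖b‖) ^ τ))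
  rw [mul_left_comm]
  refine mul_le_mul_of_nonneg_left ?_ (hm a)
  have h_base : 1 + ‖a‖ ≤ (1 + ‖b‖) * (1 + ‖a - b‖) := by
    nlinarith [norm_le_norm_sub_add a b, mul_nonneg (norm_nonneg b) (norm_nonneg (a - b))]
  rw [rpow_neg (by positivity), rpow_neg (by positivity), ← div_eq_mul_inv,
    le_div_iff₀ (by positivity), inv_mul_le_iff₀ (by positivity), mul_comm,
    ← mul_rpow (by positivity) (by positivity)]
  exact rpow_le_rpow (by positivity) h_base hτ

lemma exists_isExceptional_sum_natAbs_divisor_le (hf : Meromorphic f) (hσ : order f ≤ σ) (b : ℂ)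
    (hε : 0 < ε) :
    ∃ E, IsExceptional E ∧ ∀ s, 1 < s → s ∉ E → ∀ F : Finset ℂ, (∀ a ∈ F, ‖a - b‖ ≤ 4 * s) →
      ∑ a ∈ F, ((divisor f univ a).natAbs : ℝ) * |s - ‖a - b‖|⁻¹
        ≤ s ^ (zerosPolesExponent f + ε - 1) := by
  obtain ⟨τ, hτ⟩ : ∃ τ, τ = zerosPolesExponent f + ε / 2 := ⟨_, rfl⟩
  have hlam := zerosPolesExponent_nonneg f
  have hτ₀ : 0 < τ := by linarith
  have h_pos : 0 < zerosPolesExponent f + ε := by linarith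
  have h_sum := summable_natAbs_divisor hf hσ (hτ ▸ lt_add_of_pos_right _ (half_pos hε))
  obtain ⟨E, hE, h⟩ := exists_isExceptional_sum_inv_le (fun a => norm_nonneg (a - b))
    (div_pos hτ₀ h_pos) ((div_lt_one h_pos).2 (by linarith)) hτ₀
    (summable_mul_one_add_norm_sub_rpow (fun a => Nat.cast_nonneg _) hτ₀.le h_sum b)
  rw [div_div_cancel₀ hτ₀.ne'] at h
  exact ⟨E, hE, h⟩

lemma exists_isExceptional_norm_ne {B : Set ℂ} (hB : B.Countable) :
    ∃ E, IsExceptional E ∧ ∀ s, 1 < s → s ∉ E → ∀ b ∈ B, s ≠ ‖b‖ :=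
  ⟨norm '' B ∩ Ioi 1,
    isExceptional_of_countable ((hB.image _).mono inter_subset_left) inter_subset_right,
    fun _ hs hsE b hb h => hsE ⟨⟨b, hb, h.symm⟩, hs⟩⟩

lemma exists_isExceptional_norm_ne_of_not_isRegularAt (hf : Meromorphic f)
    (h_order : ∀ z, meromorphicOrderAt f z ≠ ⊤) (η : ℂ) :
    ∃ E, IsExceptional E ∧ ∀ s, 1 < s → s ∉ E → ∀ a, ¬IsRegularAt f a → s ≠ ‖a‖ ∧ s ≠ ‖a - η‖ := by
  have h_countable := countable_compl_isRegularAt hf h_order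
  obtain ⟨E, hE, h⟩ := exists_isExceptional_norm_ne
    (h_countable.union (h_countable.image fun a => a - η))
  exact ⟨E, hE, fun s hs hsE a ha =>
    ⟨h s hs hsE a (.inl ha), h s hs hsE _ (.inr (mem_image_of_mem _ ha))⟩⟩

lemma exists_isExceptional_norm_zerosPolesRemainder_le (hf : Meromorphic f) (hσ : order f ≤ σ)
    (η : ℂ) (hε : 0 < ε) :
    ∃ E, IsExceptional E ∧ ∃ K : ℝ, ∀ z : ℂ, 1 < ‖z‖ → ‖z‖ ∉ E → ‖η‖ ≤ ‖z‖ →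
      ∀ F : Finset ℂ, (∀ a ∈ F, ‖a‖ ≤ 3 * ‖z‖) → (∀ a ∈ F, ‖z‖ ≠ ‖a‖ ∧ ‖z‖ ≠ ‖a - η‖) →
        ‖zerosPolesRemainder F (divisor f univ) η z‖
          ≤ K * ‖z‖ ^ (beta σ (zerosPolesExponent f) + ε) := by
  obtain ⟨E₁, hE₁, h₁⟩ := exists_isExceptional_sum_natAbs_divisor_le hf hσ 0 (half_pos hε)
  obtain ⟨E₂, hE₂, h₂⟩ := exists_isExceptional_sum_natAbs_divisor_le hf hσ η (half_pos hε)
  obtain ⟨K, h⟩ := exists_norm_zerosPolesRemainder_le η σ (zerosPolesExponent f) hε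
  refine ⟨E₁ ∪ E₂, hE₁.union hE₂, K, fun z hz hzE hηz F hF h_ne => ?_⟩
  simp only [sub_zero] at h₁
  have hzE := not_or.1 hzE
  refine h F _ z hz.le (fun a ha => (h_ne a ha).1) (fun a ha => (h_ne a ha).2)
    (h₁ _ hz hzE.1 F fun a ha => ?_) (h₂ _ hz hzE.2 F fun a ha => ?_)
  · linarith [hF a ha]
  · linarith [hF a ha, norm_sub_le a η]

lemma schwarz_constant_le {r h : ℝ} (hr : 0 < r) (hhr : h ≤ r) :
    2 * (3 * r) * h ^ 2 / ((3 * r - r) ^ 2 * (3 * r - r - h)) ≤ 3 / 2 * h ^ 2 * r ^ (-2 : ℝ) := by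
  rw [rpow_neg hr.le, rpow_two, ← div_eq_mul_inv,
    div_le_div_iff₀ (mul_pos (by nlinarith) (by linarith)) (by positivity)]
  have : 0 ≤ h ^ 2 * r ^ 2 * (r - h) := mul_nonneg (by positivity) (by linarith)
  linarith

lemma rpow_neg_two_mul_rpow_le {r s b : ℝ} (hr : 1 ≤ r) (hs : s - 2 ≤ b) :
    r ^ (-2 : ℝ) * (3 * r) ^ (s + ε) ≤ 3 ^ (s + ε) * r ^ (b + ε) := by
  rw [mul_rpow (by norm_num) (by linarith), mul_left_comm, ← rpow_add (by linarith)]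
  exact mul_le_mul_of_nonneg_left (rpow_le_rpow_of_exponent_le hr (by linarith)) (by positivity)

lemma exists_eventually_schwarz_bound_le (hf : Meromorphic f) (hσ : order f ≤ σ) (η : ℂ)
    (hε : 0 < ε) :
    ∃ K : ℝ, ∀ᶠ r in atTop, ∀ F g, IsDiskFactorization f (divisor f univ) (3 * r) F g →
      2 * (3 * r) * ‖η‖ ^ 2 / ((3 * r - r) ^ 2 * (3 * r - r - ‖η‖))
        * circleAverage (fun ζ => |log ‖g ζ‖|) 0 (3 * r)
        ≤ K * r ^ (beta σ (zerosPolesExponent f) + ε) := by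
  obtain ⟨K, hK, h⟩ := exists_circleAverage_factor_le hf hσ hε
  set lam := zerosPolesExponent f
  refine ⟨3 / 2 * ‖η‖ ^ 2 * (K * (3 ^ (σ + ε) + 3 ^ (lam + ε))), ?_⟩
  filter_upwards [(tendsto_id.const_mul_atTop three_pos).eventually h, eventually_ge_atTop 1,
    eventually_ge_atTop ‖η‖] with r h hr hrη F g hfg
  have h_σ : r ^ (-2 : ℝ) * (3 * r) ^ (σ + ε) ≤ 3 ^ (σ + ε) * r ^ (beta σ lam + ε) :=
    rpow_neg_two_mul_rpow_le hr (sub_two_le_beta σ lam)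
  have h_lam : r ^ (-2 : ℝ) * (3 * r) ^ (lam + ε) ≤ 3 ^ (lam + ε) * r ^ (beta σ lam + ε) :=
    rpow_neg_two_mul_rpow_le hr (exponent_sub_two_le_beta σ (zerosPolesExponent_nonneg f))
  calc _ ≤ 3 / 2 * ‖η‖ ^ 2 * r ^ (-2 : ℝ) *
        (K * ((3 * r) ^ (σ + ε) + (3 * r) ^ (lam + ε))) :=
        mul_le_mul (schwarz_constant_le (by linarith) hrη) (h F g hfg)
          (circleAverage_nonneg_of_nonneg fun _ _ => abs_nonneg _) (by positivity)
    _ = 3 / 2 * ‖η‖ ^ 2 * (K * (r ^ (-2 : ℝ) * (3 * r) ^ (σ + ε) +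
          r ^ (-2 : ℝ) * (3 * r) ^ (lam + ε))) := by ring
    _ ≤ 3 / 2 * ‖η‖ ^ 2 * (K * (3 ^ (σ + ε) * r ^ (beta σ lam + ε) +
          3 ^ (lam + ε) * r ^ (beta σ lam + ε))) := by gcongr
    _ = _ := by ring

lemma exists_isExceptional_quotient_eq_exp (hf : Meromorphic f)
    (h_order : ∀ z, meromorphicOrderAt f z ≠ ⊤) (hσ : order f ≤ σ) (η : ℂ) (hε : 0 < ε) :
    ∃ E, IsExceptional E ∧
      (∀ z : ℂ, 1 < ‖z‖ → ‖z‖ ∉ E → IsRegularAt f z ∧ IsRegularAt f (z + η)) ∧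
      ∃ K : ℝ, ∀ᶠ r in atTop, ∀ z : ℂ, ‖z‖ = r → r ∉ E →
        ∃ ρ, f (z + η) / f z = Complex.exp (η * logDeriv f z + ρ) ∧
          ‖ρ‖ ≤ K * r ^ (beta σ (zerosPolesExponent f) + ε) := by
  obtain ⟨E₁, hE₁, h_ne⟩ := exists_isExceptional_norm_ne_of_not_isRegularAt hf h_order η
  obtain ⟨E₂, hE₂, K₁, h_zerosPoles⟩ :=
    exists_isExceptional_norm_zerosPolesRemainder_le hf hσ η hε
  obtain ⟨K₂, h_schwarz⟩ := exists_eventually_schwarz_bound_le hf hσ η hε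
  have h_regular : ∀ z : ℂ, 1 < ‖z‖ → ‖z‖ ∉ E₁ → IsRegularAt f z ∧ IsRegularAt f (z + η) :=
    fun z hz hzE => ⟨by_contra fun h => (h_ne _ hz hzE z h).1 rfl,
      by_contra fun h => (h_ne _ hz hzE _ h).2 (by rw [add_sub_cancel_right])⟩
  refine ⟨E₁ ∪ E₂, hE₁.union hE₂, fun z hz hzE => h_regular z hz (not_or.1 hzE).1, K₁ + K₂, ?_⟩
  filter_upwards [h_schwarz, eventually_gt_atTop 1, eventually_gt_atTop ‖η‖]
    with r h_schwarz hr hηr z hzr hrE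
  subst hzr
  have hrE := not_or.1 hrE
  obtain ⟨hz, hzη⟩ := h_regular z hr hrE.1
  obtain ⟨F, g, hfg⟩ := exists_isDiskFactorization hf h_order (3 * ‖z‖)
  have h_notMem : ∀ w, IsRegularAt f w → w ∉ F := fun w hw hwF =>
    hfg.exponent_ne_zero w hwF (hw.divisor_eq_zero hf)
  obtain ⟨ρ, hρ, hρ_le⟩ := hfg.exists_quotient_eq_exp hz.1 hzη.1 (h_notMem z hz)
    (h_notMem _ hzη) (by linarith)
  refine ⟨_, hρ, (norm_add_le _ _).trans ?_⟩
  rw [add_mul]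
  refine add_le_add (h_zerosPoles z hr hrE.2 hηr.le F hfg.norm_le fun a ha => ?_)
    (hρ_le.trans (h_schwarz F g hfg))
  exact h_ne _ hr hrE.1 a fun h => h_notMem a h ha

lemma exists_isBigOModulus_of_eventually {P : ℂ → ℂ → Prop} {S : Set ℝ} {ψ : ℝ → ℝ}
    (hψ : ∀ r, 0 < r → 0 ≤ ψ r) {K : ℝ}
    (h_large : ∀ᶠ r in atTop, ∀ z : ℂ, ‖z‖ = r → r ∉ S → ∃ ρ, P z ρ ∧ ‖ρ‖ ≤ K * ψ r)
    (h : ∀ z : ℂ, ‖z‖ ∉ S → ∃ ρ, P z ρ) :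
    ∃ R, IsBigOModulus R ψ ∧ ∀ z : ℂ, ‖z‖ ∉ S → P z (R z) := by
  obtain ⟨r₀, hr₀⟩ := eventually_atTop.1 h_large
  have h_point : ∀ z : ℂ, ∃ ρ, (max r₀ 1 < ‖z‖ → ‖ρ‖ ≤ max K 1 * ψ ‖z‖) ∧ (‖z‖ ∉ S → P z ρ) := by
    intro z
    by_cases hzS : ‖z‖ ∈ S
    · refine ⟨0, fun hz => ?_, fun h => absurd hzS h⟩
      have := hψ ‖z‖ (one_pos.trans ((le_max_right _ _).trans_lt hz))
      rw [norm_zero]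
      positivity
    · rcases lt_or_ge (max r₀ 1) ‖z‖ with hz | hz
      · obtain ⟨ρ, hρ, hρ_le⟩ := hr₀ _ ((le_max_left _ _).trans hz.le) z rfl hzS
        refine ⟨ρ, fun _ => hρ_le.trans ?_, fun _ => hρ⟩
        have := hψ ‖z‖ (one_pos.trans ((le_max_right _ _).trans_lt hz))
        gcongr
        exact le_max_left _ _
      · obtain ⟨ρ, hρ⟩ := h z hzS
        exact ⟨ρ, fun hz' => absurd hz' hz.not_gt, fun _ => hρ⟩
  choose R hR_le hR using h_point
  exact ⟨R, ⟨max r₀ 1, by positivity, max K 1, by positivity, hR_le⟩, hR⟩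

lemma exists_int_two_pi_I_mul_add_log_exp (w : ℂ) :
    ∃ n : ℤ, 2 * π * Complex.I * n + Complex.log (Complex.exp w) = w := by
  obtain ⟨n, hn⟩ := Complex.log_exp_exists w
  refine ⟨-n, ?_⟩
  rw [hn]
  push_cast
  ring

end DifferenceQuotient

end MeromorphicGrowth

/-- A meromorphic function is represented by `f : ℂ → ℂ` with arbitrary values on a discrete set
(such as its poles), so "not identically zero" is read up to a discrete set, and the conclusion
says that, off the exceptional radii, `f` is regular and nonzero at `z` and at `z + η`. The
exponents of convergence of a function of finite order are finite, so `toReal` loses nothing. -/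
theorem theorem2p1 (f : ℂ → ℂ) (hf : Meromorphic f) (hf0 : ¬ f =ᶠ[codiscrete ℂ] 0)
    (σ : ℝ) (hσ : MeromorphicGrowth.order f = (σ : EReal))
    (η : ℂ) (hη : η ≠ 0) (ε : ℝ) (hε : 0 < ε) :
    ∃ E : Set ℝ, E ⊆ Ioi 1 ∧ MeasurableSet E ∧ MeromorphicGrowth.logMeasure E < ⊤ ∧
      (∀ z : ℂ, ‖z‖ ∉ E ∪ Icc 0 1 →
        AnalyticAt ℂ f z ∧ f z ≠ 0 ∧ AnalyticAt ℂ f (z + η) ∧ f (z + η) ≠ 0) ∧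
      (∃ (n : ℂ → ℤ) (R : ℂ → ℂ),
        MeromorphicGrowth.IsBigOModulus R (fun r => r ^ (MeromorphicGrowth.beta σ
          (max (MeromorphicGrowth.zerosExponent f) (MeromorphicGrowth.polesExponent f)).toReal
            + ε)) ∧
        ∀ z : ℂ, ‖z‖ ∉ E ∪ Icc 0 1 →
          2 * Real.pi * Complex.I * (n z : ℂ) + Complex.log (f (z + η) / f z)
            = η * (deriv f z / f z) + R z) ∧
      (∃ R : ℂ → ℂ,
        MeromorphicGrowth.IsBigOModulus R (fun r => r ^ (MeromorphicGrowth.beta σ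
          (max (MeromorphicGrowth.zerosExponent f) (MeromorphicGrowth.polesExponent f)).toReal
            + ε)) ∧
        ∀ z : ℂ, ‖z‖ ∉ E ∪ Icc 0 1 →
          f (z + η) / f z = Complex.exp (η * (deriv f z / f z) + R z)) := by
  obtain ⟨E, hE, h_regular, K, h_quot⟩ :=
    MeromorphicGrowth.exists_isExceptional_quotient_eq_exp hf
      (MeromorphicGrowth.meromorphicOrderAt_ne_top_of_not_eventuallyEq_zero hf hf0) hσ.le η hε
  replace h_regular : ∀ z : ℂ, ‖z‖ ∉ E ∪ Icc 0 1 →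
      MeromorphicGrowth.IsRegularAt f z ∧ MeromorphicGrowth.IsRegularAt f (z + η) := fun z hz =>
    h_regular z (not_le.1 fun h => hz (.inr ⟨norm_nonneg z, h⟩)) fun h => hz (.inl h)
  obtain ⟨R, hR, h_exp⟩ := MeromorphicGrowth.exists_isBigOModulus_of_eventually
    (P := fun z ρ => f (z + η) / f z = Complex.exp (η * (deriv f z / f z) + ρ))
    (fun _ hr => Real.rpow_nonneg hr.le _)
    (h_quot.mono fun _ h z hzr hr => h z hzr fun hrE => hr (.inl hrE)) fun z hz =>
      have ⟨hz, hzη⟩ := h_regular z hz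
      ⟨Complex.log (f (z + η) / f z) - η * (deriv f z / f z), by
        rw [add_sub_cancel, Complex.exp_log (div_ne_zero hzη.2 hz.2)]⟩
  choose n hn using MeromorphicGrowth.exists_int_two_pi_I_mul_add_log_exp
  refine ⟨E, hE.subset_Ioi, hE.measurableSet, hE.logMeasure_lt_top,
    fun z hz => and_assoc.1 (h_regular z hz),
    ⟨fun z => n (η * (deriv f z / f z) + R z), R, hR, fun z hz => ?_⟩, R, hR, h_exp⟩
  rw [h_exp z hz, hn]
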